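/- Let $\mathcal G=(\mathbb V,\mathbb E)$ be a metric graph (loops and multiple edges allowed) whose edges are bounded intervals or half-lines, each half-line being attached to the rest of the graph at its finite end point and having at its other end a ``vertex at infinity'' of degree one. Assume that $\mathcal G$ belongs to the class $\mathbf G$: it is connected, it has at most countably many edges, every vertex has finite degree (the degree being the number of edges incident at the vertex), and the edge lengths are bounded away from $0$. Assume further that $\mathcal G$ is noncompact, i.e. it has at least one half-line or infinitely many edges. Let $Z$ be a (possibly empty or infinite) set of vertices of degree $1$ that are not vertices at infinity, let $p>2$, and set $$H^1_Z(\mathcal G)=\{u\in H^1(\mathcal G): u(\mathrm v)=0\ \text{for all } \mathrm v\in Z\},\qquad \omega_Z(\mathcal G)=\inf_{v\in H^1_Z(\mathcal G)\setminus\{0\}}\frac{\|v'\|_{L^2(\mathcal G)}^2}{\|v\|_{L^2(\mathcal G)}^2},$$ where $H^1(\mathcal G)$ is the space of real-valued continuous functions $u$ on $\mathcal G$ that are $H^1$ on every edge and satisfy $\|u\|_{L^2(\mathcal G)}^2+\|u'\|_{L^2(\mathcal G)}^2<\infty$. For $\lambda\in\mathbb R$ let $$J_\lambda(u)=\tfrac12\|u'\|_{L^2(\mathcal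 G)}^2+\tfrac{\lambda}{2}\|u\|_{L^2(\mathcal G)}^2-\tfrac1p\|u\|_{L^p(\mathcal G)}^p ,\qquad u\in H^1_Z(\mathcal G),$$ $$\mathcal N_{\lambda,Z}(\mathcal G)=\{u\in H^1_Z(\mathcal G): u\neq0,\ \|u'\|_{L^2(\mathcal G)}^2+\lambda\|u\|_{L^2(\mathcal G)}^2=\|u\|_{L^p(\mathcal G)}^p\},$$ $$\mathcal M_{\lambda,Z}(\mathcal G)=\{u\in H^1_Z(\mathcal G): u^+\in\mathcal N_{\lambda,Z}(\mathcal G)\ \text{and}\ u^-\in\mathcal N_{\lambda,Z}(\mathcal G)\},\qquad u^+=\max(u,0),\ u^-=\min(u,0).$$ A nodal ground state is a function $u\in\mathcal M_{\lambda,Z}(\mathcal G)$ with $J_\lambda(u)=\inf_{v\in\mathcal M_{\lambda,Z}(\mathcal G)}J_\lambda(v)$. **Theorem.** For every such noncompact graph $\mathcal G\in\mathbf G$, every such $Z$ and $p$, and every real $\lambda>-\omega_Z(\mathcal G)$, $$\inf_{v\in\mathcal M_{\lambda,Z}(\mathcal G)}J_\lambda(v)\ \ge\ 2\inf_{v\in\mathcal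 N_{\lambda,Z}(\mathcal G)}J_\lambda(v).$$ If equality holds, then $\mathcal G$ admits no nodal ground state. -/

import Mathlib

open MeasureTheory
open scoped ENNReal

/-- A metric graph with set of (finite) vertices `V` and set of edges `E`; loops and multiple edges
are allowed. An edge `e` of finite length is identified with the interval `[0, len e]`, the points
`0` and `len e` being glued to the vertices `tail e` and `head e`. An edge of infinite length is a
half-line `[0, ∞)`, attached to the graph at `tail e`; its other end is a vertex at infinity, which
is of degree one, is not an element of `V`, and is not a point of the metric space. -/
structure MetricGraph (V E : Type*) where
  /-- the length of an edge -/
  len : E → ℝ≥0∞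
  /-- lengths are positive -/
  len_pos : ∀ e, 0 < len e
  /-- the vertex at the coordinate `0` -/
  tail : E → V
  /-- the vertex at the coordinate `len e`, when the edge is bounded -/
  head : (e : E) → len e ≠ ⊤ → V

namespace MetricGraph

variable {V E : Type*} (G : MetricGraph V E)

/-- The number of edges incident at the vertex `v`, a loop being counted twice. -/
noncomputable def degree (v : V) : ℕ∞ :=
  {e : E | G.tail e = v}.encard + {e : E | ∃ h : G.len e ≠ ⊤, G.head e h = v}.encard

/-- The underlying combinatorial graph on the vertices: two distinct vertices are adjacent when
they are joined by a (bounded) edge. -/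
def adjacency : SimpleGraph V :=
  SimpleGraph.fromRel fun v w => ∃ (e : E) (h : G.len e ≠ ⊤), G.tail e = v ∧ G.head e h = w

/-- The class `𝐆`: connected metric graphs with at most countably many edges, all vertices of finite
degree, and edge lengths bounded away from zero. (Half-lines are attached to vertices, so that
connectedness may be read off from the bounded edges.) -/
structure IsInClassG : Prop where
  countable_edges : Countable E
  connected : G.adjacency.Connected
  degree_finite : ∀ v, G.degree v < ⊤
  len_bounded_below : 0 < ⨅ e, G.len e

/-- The graph is noncompact: it has a half-line or infinitely many edges. -/
def IsNoncompact : Prop := (∃ e, G.len e = ⊤) ∨ Infinite E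

/-- The points of the metric graph: its vertices, and the interior points of its edges. -/
inductive Point : Type _
  | vertex (v : V) : Point
  | interior (e : E) (x : ℝ) (hx₀ : 0 < x) (hx₁ : ENNReal.ofReal x < G.len e) : Point

open Classical in
/-- The point of coordinate `x` on the edge `e` (coordinates beyond the ends of the edge give
the ends). -/
noncomputable def pt (e : E) (x : ℝ) : G.Point :=
  if hx₀ : x ≤ 0 then Point.vertex (G.tail e)
  else if hx₁ : G.len e ≤ ENNReal.ofReal x then
    Point.vertex (G.head e (ne_top_of_le_ne_top ENNReal.ofReal_ne_top hx₁))
  else Point.interior e x (not_le.mp hx₀) (not_le.mp hx₁)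

/-- The restriction `u_e` of a function `u` on the graph to the edge `e`, as a function of the
coordinate. -/
noncomputable def restr (u : G.Point → ℝ) (e : E) : ℝ → ℝ := fun x => u (G.pt e x)

/-- The derivative `u'` of a function `u` on the graph, edge by edge. -/
noncomputable def derivative (u : G.Point → ℝ) (e : E) : ℝ → ℝ := deriv (G.restr u e)

/-- The open interval `(0, len e)` of coordinates of the edge `e`. -/
def openEdge (e : E) : Set ℝ := {x : ℝ | 0 < x ∧ ENNReal.ofReal x < G.len e}

/-- For a function `f = (f_e)` given edge by edge, `‖f‖_{L^q(G)}^q = ∑_e ∫_e |f_e|^q`, a value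
in `[0, ∞]`. -/
noncomputable def eLpPow (q : ℝ) (f : E → ℝ → ℝ) : ℝ≥0∞ :=
  ∑' e, ∫⁻ x in G.openEdge e, ‖f e x‖ₑ ^ q

/-- `‖f‖_{L^q(G)}^q` as a real number. -/
noncomputable def lpPow (q : ℝ) (f : E → ℝ → ℝ) : ℝ := (G.eLpPow q f).toReal

/-- The Sobolev space `H¹(G)`: functions on the graph whose restriction to each edge `e` is
absolutely continuous on every compact subinterval of `[0, len e]` (of `[0, ∞)` if `e` is a
half-line), with `u` and `u'` in `L²(G)`. Such functions are continuous on the graph, as on all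
edges incident at a vertex they have there the same value, `u` being a function of points. -/
def H1 : Set (G.Point → ℝ) :=
  {u | (∀ (e : E) (a b : ℝ), 0 ≤ a → a ≤ b → ENNReal.ofReal b ≤ G.len e →
          AbsolutelyContinuousOnInterval (G.restr u e) a b) ∧
        G.eLpPow 2 (G.restr u) < ⊤ ∧ G.eLpPow 2 (G.derivative u) < ⊤}

/-- The space `H¹_Z(G)` of the functions in `H¹(G)` that vanish on the set of vertices `Z`. -/
def H1Z (Z : Set V) : Set (G.Point → ℝ) :=
  {u | u ∈ G.H1 ∧ ∀ v ∈ Z, u (Point.vertex v) = 0}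

/-- The bottom of the spectrum
`ω_Z(G) = inf {‖v'‖₂² / ‖v‖₂² : v ∈ H¹_Z(G), v ≠ 0}`. -/
noncomputable def omega (Z : Set V) : EReal :=
  ⨅ v ∈ {v : G.Point → ℝ | v ∈ G.H1Z Z ∧ v ≠ 0},
    ((G.lpPow 2 (G.derivative v) / G.lpPow 2 (G.restr v) : ℝ) : EReal)

/-- The action functional `J_λ`, for the exponent `p` and the parameter `lam`. -/
noncomputable def action (p lam : ℝ) (u : G.Point → ℝ) : ℝ :=
  1 / 2 * G.lpPow 2 (G.derivative u) + lam / 2 * G.lpPow 2 (G.restr u)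
    - 1 / p * G.lpPow p (G.restr u)

/-- The Nehari manifold `N_{λ,Z}(G)`. -/
def nehari (p lam : ℝ) (Z : Set V) : Set (G.Point → ℝ) :=
  {u | u ∈ G.H1Z Z ∧ u ≠ 0 ∧
    G.lpPow 2 (G.derivative u) + lam * G.lpPow 2 (G.restr u) = G.lpPow p (G.restr u)}

/-- The nodal Nehari set `M_{λ,Z}(G)`: functions `u` in `H¹_Z(G)` such that both `max (u, 0)` and
`min (u, 0)` belong to the Nehari manifold. -/
def nodalNehari (p lam : ℝ) (Z : Set V) : Set (G.Point → ℝ) :=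
  {u | u ∈ G.H1Z Z ∧ (fun x => max (u x) 0) ∈ G.nehari p lam Z ∧
    (fun x => min (u x) 0) ∈ G.nehari p lam Z}

/-- The ground state level `inf J_λ` over the Nehari manifold. -/
noncomputable def groundLevel (p lam : ℝ) (Z : Set V) : EReal :=
  ⨅ v ∈ G.nehari p lam Z, (G.action p lam v : EReal)

/-- The nodal ground state level `inf J_λ` over the nodal Nehari set. -/
noncomputable def nodalLevel (p lam : ℝ) (Z : Set V) : EReal :=
  ⨅ v ∈ G.nodalNehari p lam Z, (G.action p lam v : EReal)

/-- `u` is a nodal ground state: it belongs to the nodal Nehari set and minimizes `J_λ` there. -/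
def IsNodalGroundState (p lam : ℝ) (Z : Set V) (u : G.Point → ℝ) : Prop :=
  u ∈ G.nodalNehari p lam Z ∧ (G.action p lam u : EReal) = G.nodalLevel p lam Z

end MetricGraph

/-! The inequality is additivity: `u⁺` and `u⁻` never live at the same point, so the action of `u`
is the sum of their actions (`action_eq_add`), and each part lies on the Nehari manifold.

Suppose equality holds and `u` is a nodal ground state. Then `w = u⁺` minimizes the action on the
Nehari manifold. Rescaling shows that `w` minimizes the quadratic form among functions with at least
its `L^p` norm (`quadForm_le_of_minimizer`). Adding `tφ` with `t > 0`, `φ ≥ 0` does not decrease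
that norm, so the first variation is nonnegative: `w` is a weak supersolution of `-w'' + λw = 0`.
This inequality suffices; the Euler-Lagrange equation and regularity of `w` are never needed.

A strong maximum principle (`IsSupersolution.eq_zero`) now says that `w` is zero if it vanishes at
one interior point of an edge. Since `u⁻ ≠ 0`, there is such a point, contradicting `u⁺ ≠ 0`. The
principle is proved by testing with small tents centred at zeros of `w`. The derivative term is
minus the sum of the values of `w` at distance `ε` from the centres, while the zeroth-order term is
`O(ε²)` times the maximum of such sums; hence `w` vanishes near the centres
(`exists_forall_restr_eq_zero`). One tent treats an interior point; a tent on every edge end at a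
vertex treats the vertex, and connectedness propagates the zero. -/

/-! ### Absolute continuity on intervals -/

theorem AbsolutelyContinuousOnInterval.congr {f g : ℝ → ℝ} {a b : ℝ}
    (hf : AbsolutelyContinuousOnInterval f a b) (h : Set.EqOn f g (Set.uIcc a b)) :
    AbsolutelyContinuousOnInterval g a b := by
  rw [absolutelyContinuousOnInterval_iff] at hf ⊢
  intro ε hε
  obtain ⟨δ, hδ, H⟩ := hf ε hε
  refine ⟨δ, hδ, fun I hI hs => ?_⟩
  have := H I hI hs
  refine lt_of_eq_of_lt (Finset.sum_congr rfl fun i hi => ?_) this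
  have h2 := hI.1 i hi
  rw [h h2.1, h h2.2]

/-- Extending an absolutely continuous function by constants keeps it absolutely continuous. -/
theorem AbsolutelyContinuousOnInterval.comp_clamp {f : ℝ → ℝ} {c d : ℝ} (hcd : c ≤ d)
    (hf : AbsolutelyContinuousOnInterval f c d) (a b : ℝ) :
    AbsolutelyContinuousOnInterval (fun x => f (max c (min x d))) a b := by
  rw [absolutelyContinuousOnInterval_iff] at hf ⊢
  intro ε hε
  obtain ⟨δ, hδ, H⟩ := hf ε hε
  refine ⟨δ, hδ, fun I hI hs => ?_⟩
  have hmem : ∀ x, max c (min x d) ∈ Set.uIcc c d := fun x => by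
    rw [Set.uIcc_of_le hcd]
    exact ⟨le_max_left _ _, max_le hcd (min_le_right _ _)⟩
  refine H (I.1, fun i => (max c (min (I.2 i).1 d), max c (min (I.2 i).2 d)))
    ⟨fun i _ => ⟨hmem _, hmem _⟩, ?_⟩ (lt_of_le_of_lt (Finset.sum_le_sum fun i _ => ?_) hs)
  · intro i hi j hj hij
    -- Clamping its end points only shrinks an interval to a subinterval of itself, so disjointness
    -- survives and lengths do not increase.
    refine Set.disjoint_left.mpr fun z hz hz' =>
      Set.disjoint_left.mp (hI.2 hi hj hij) (show z ∈ _ from ?_) (show z ∈ _ from ?_)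
    · simp only [Set.uIoc, Set.mem_Ioc] at hz ⊢
      grind
    · simp only [Set.uIoc, Set.mem_Ioc] at hz' ⊢
      grind
  · rw [Real.dist_eq, Real.dist_eq]
    grind

/-! ### Edges and restrictions of functions to them -/

namespace MetricGraph

variable {V E : Type*} (G : MetricGraph V E)

theorem pt_of_nonpos (e : E) {x : ℝ} (hx : x ≤ 0) : G.pt e x = Point.vertex (G.tail e) := by
  simp [pt, hx]

theorem pt_of_len_le (e : E) {x : ℝ} (hx : 0 < x) (h : G.len e ≤ ENNReal.ofReal x) :
    G.pt e x = Point.vertex (G.head e (ne_top_of_le_ne_top ENNReal.ofReal_ne_top h)) := by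
  simp [pt, hx.not_ge, h]

theorem pt_of_mem_openEdge (e : E) {x : ℝ} (hx : x ∈ G.openEdge e) :
    G.pt e x = Point.interior e x hx.1 hx.2 := by
  simp [pt, hx.1.not_ge, hx.2.not_ge]

theorem toReal_len_pos (e : E) (h : G.len e ≠ ⊤) : 0 < (G.len e).toReal :=
  ENNReal.toReal_pos (G.len_pos e).ne' h

theorem pt_toReal_len (e : E) (h : G.len e ≠ ⊤) :
    G.pt e (G.len e).toReal = Point.vertex (G.head e h) :=
  G.pt_of_len_le e (G.toReal_len_pos e h) (ENNReal.ofReal_toReal h).ge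

theorem openEdge_of_eq_top (e : E) (h : G.len e = ⊤) : G.openEdge e = Set.Ioi 0 := by
  ext x; simp [openEdge, h]

theorem openEdge_of_ne_top (e : E) (h : G.len e ≠ ⊤) :
    G.openEdge e = Set.Ioo 0 (G.len e).toReal := by
  ext x
  simp only [openEdge, Set.mem_ofPred_eq, Set.mem_Ioo]
  exact and_congr_right fun _ => ENNReal.ofReal_lt_iff_lt_toReal (by order) h

theorem isOpen_openEdge (e : E) : IsOpen (G.openEdge e) := by
  by_cases h : G.len e = ⊤
  · rw [G.openEdge_of_eq_top e h]; exact isOpen_Ioi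
  · rw [G.openEdge_of_ne_top e h]; exact isOpen_Ioo

theorem isPreconnected_openEdge (e : E) : IsPreconnected (G.openEdge e) := by
  by_cases h : G.len e = ⊤
  · rw [G.openEdge_of_eq_top e h]; exact isPreconnected_Ioi
  · rw [G.openEdge_of_ne_top e h]; exact isPreconnected_Ioo

theorem measurableSet_openEdge (e : E) : MeasurableSet (G.openEdge e) :=
  (G.isOpen_openEdge e).measurableSet

variable {G}

/-- `restr` is constant beyond the ends of the edge, so it is its own clamping. Having arbitrary
`a`, `b` lets tents stick out of the edge at a vertex. -/
theorem H1.absolutelyContinuousOnInterval {u : G.Point → ℝ} (hu : u ∈ G.H1) (e : E) (a b : ℝ) :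
    AbsolutelyContinuousOnInterval (G.restr u e) a b := by
  obtain ⟨d, hd, hdl, heq⟩ : ∃ d, 0 ≤ d ∧ ENNReal.ofReal d ≤ G.len e ∧
      ∀ x ∈ Set.uIcc a b, G.restr u e (max 0 (min x d)) = G.restr u e x := by
    have h0 : ∀ x ≤ 0, G.restr u e x = G.restr u e 0 := fun x hx => by
      simp [restr, G.pt_of_nonpos e hx, G.pt_of_nonpos e le_rfl]
    by_cases h : G.len e = ⊤
    -- On a half-line, any nonnegative bound beyond `a` and `b` makes the upper clamp inactive.
    · refine ⟨max 0 (max a b), le_max_left _ _, by simp [h], fun x hx => ?_⟩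
      rw [min_eq_left (hx.2.trans (le_max_right _ _))]
      rcases le_total x 0 with h1 | h1
      · rw [max_eq_left h1, h0 x h1]
      · rw [max_eq_right h1]
    · have hL := G.toReal_len_pos e h
      refine ⟨(G.len e).toReal, hL.le, (ENNReal.ofReal_toReal h).le, fun x _ => ?_⟩
      rcases le_total x 0 with h1 | h1
      · rw [min_eq_left (by order), max_eq_left h1, h0 x h1]
      · rcases le_total x (G.len e).toReal with h2 | h2
        · rw [min_eq_left h2, max_eq_right h1]
        · rw [min_eq_right h2, max_eq_right hL.le]
          have h3 : G.len e ≤ ENNReal.ofReal x := ENNReal.le_ofReal_iff_toReal_le h h1 |>.2 h2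
          simp only [restr]
          rw [G.pt_toReal_len e h, G.pt_of_len_le e (by order) h3]
  exact (AbsolutelyContinuousOnInterval.comp_clamp hd (hu.1 e 0 d le_rfl hd hdl) a b).congr heq

theorem H1.continuous_restr {u : G.Point → ℝ} (hu : u ∈ G.H1) (e : E) :
    Continuous (G.restr u e) := by
  rw [continuous_iff_continuousAt]
  intro x
  refine (H1.absolutelyContinuousOnInterval hu e (x - 1) (x + 1)).continuousOn.continuousAt ?_
  rw [Set.uIcc_of_le (by linarith)]
  exact Icc_mem_nhds (by linarith) (by linarith)

theorem H1.ae_differentiableAt_restr {u : G.Point → ℝ} (hu : u ∈ G.H1) (e : E) :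
    ∀ᵐ x, DifferentiableAt ℝ (G.restr u e) x := by
  have : ∀ n : ℕ, ∀ᵐ x : ℝ, x ∈ Set.uIcc (-n : ℝ) n → DifferentiableAt ℝ (G.restr u e) x :=
    fun n => (H1.absolutelyContinuousOnInterval hu e _ _).boundedVariationOn
      |>.ae_differentiableAt_of_mem_uIcc
  filter_upwards [ae_all_iff.2 this] with x hx
  obtain ⟨n, hn⟩ := exists_nat_ge |x|
  refine hx n ?_
  rw [Set.uIcc_of_le (by linarith [abs_nonneg x])]
  exact abs_le.1 hn

/-- Outside its edge, the derivative of the restriction vanishes. -/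
theorem derivative_ae_eq_zero (u : G.Point → ℝ) (e : E) :
    ∀ᵐ x : ℝ, x ∉ G.openEdge e → G.derivative u e x = 0 := by
  have h0 : ∀ x < 0, G.derivative u e x = 0 := fun x hx => by
    have : G.restr u e =ᶠ[nhds x] fun _ => G.restr u e 0 := by
      filter_upwards [Iio_mem_nhds hx] with y hy
      simp [restr, G.pt_of_nonpos e (le_of_lt hy), G.pt_of_nonpos e le_rfl]
    simp [derivative, this.deriv_eq]
  have h1 : ∀ᵐ x : ℝ, x ≠ 0 := by simp [ae_iff, measure_singleton]
  have h2 : ∀ᵐ x : ℝ, x ≠ (G.len e).toReal := by simp [ae_iff, measure_singleton]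
  filter_upwards [h1, h2] with x hx1 hx2 hx
  rcases lt_or_gt_of_ne hx1 with h | h
  · exact h0 x h
  by_cases ht : G.len e = ⊤
  · exact absurd (by rw [G.openEdge_of_eq_top e ht]; exact h) hx
  · rw [G.openEdge_of_ne_top e ht] at hx
    have hL : (G.len e).toReal < x := by
      rcases lt_or_gt_of_ne hx2 with h' | h'
      · exact absurd ⟨h, h'⟩ hx
      · exact h'
    have : G.restr u e =ᶠ[nhds x] fun _ => u (Point.vertex (G.head e ht)) := by
      filter_upwards [Ioi_mem_nhds hL] with y hy
      have hy0 : 0 < y := (G.toReal_len_pos e ht).trans hy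
      simp only [restr]
      rw [G.pt_of_len_le e hy0 ((ENNReal.le_ofReal_iff_toReal_le ht hy0.le).2 (le_of_lt hy))]
    simp [derivative, this.deriv_eq]

theorem measurable_derivative (u : G.Point → ℝ) (e : E) : Measurable (G.derivative u e) :=
  measurable_deriv _

/-! ### Integration over the disjoint union of the edges -/

variable (G)

/-- The Lebesgue measure on the disjoint union of the edges. -/
noncomputable def edgeMeasure : Measure (Σ _ : E, ℝ) :=
  Measure.sum fun e => (volume.restrict (G.openEdge e)).map (Sigma.mk e)

variable {G}

theorem measurableEmbedding_sigmaMk {ι : Type*} (i : ι) :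
    MeasurableEmbedding (Sigma.mk (β := fun _ : ι => ℝ) i) := by
  refine ⟨sigma_mk_injective, ?_, fun s hs => ?_⟩
  · intro s hs
    exact (MeasurableSpace.measurableSet_iInf.1 hs) i
  · refine MeasurableSpace.measurableSet_iInf.2 fun j => ?_
    change MeasurableSet (Sigma.mk j ⁻¹' (Sigma.mk (β := fun _ : ι => ℝ) i '' s))
    by_cases h : i = j
    · subst h
      rwa [Set.preimage_image_eq _ sigma_mk_injective]
    · convert MeasurableSet.empty
      ext x
      simp [h]

theorem measurable_sigma {ι β : Type*} [MeasurableSpace β] {F : (Σ _ : ι, ℝ) → β}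
    (h : ∀ i, Measurable fun x => F ⟨i, x⟩) : Measurable F := by
  intro s hs
  exact MeasurableSpace.measurableSet_iInf.2 fun j => h j hs

theorem lintegral_edgeMeasure (F : (Σ _ : E, ℝ) → ℝ≥0∞) :
    ∫⁻ s, F s ∂G.edgeMeasure = ∑' e, ∫⁻ x in G.openEdge e, F ⟨e, x⟩ := by
  rw [edgeMeasure, lintegral_sum_measure]
  exact tsum_congr fun e => (measurableEmbedding_sigmaMk e).lintegral_map _

theorem ae_edgeMeasure [Countable E] {P : (Σ _ : E, ℝ) → Prop}
    (h : ∀ e, ∀ᵐ x : ℝ, x ∈ G.openEdge e → P ⟨e, x⟩) : ∀ᵐ s ∂G.edgeMeasure, P s := by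
  rw [edgeMeasure, Measure.ae_sum_iff]
  intro e
  rw [(measurableEmbedding_sigmaMk e).ae_map_iff, ae_restrict_iff' (G.measurableSet_openEdge e)]
  exact h e

theorem restrict_edgeMeasure (e : E) :
    G.edgeMeasure.restrict (Set.range (Sigma.mk e)) =
      (volume.restrict (G.openEdge e)).map (Sigma.mk e) := by
  ext s hs
  have hr : MeasurableSet (Set.range (Sigma.mk (β := fun _ : E => ℝ) e)) :=
    (measurableEmbedding_sigmaMk e).measurableSet_range
  rw [Measure.restrict_apply hs, edgeMeasure, Measure.sum_apply _ (hs.inter hr),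
    tsum_eq_single e]
  · rw [(measurableEmbedding_sigmaMk e).map_apply, (measurableEmbedding_sigmaMk e).map_apply]
    congr 1
    ext x; simp
  · intro j hj
    rw [(measurableEmbedding_sigmaMk j).map_apply]
    convert measure_empty
    · ext x; simp [hj]
    · infer_instance

open Classical in
theorem fiber_eq_indicator (h : ℝ → ℝ) (e : E) :
    (fun s : Σ _ : E, ℝ => if s.1 = e then h s.2 else 0) =
      (Set.range (Sigma.mk e)).indicator fun s => h s.2 := by
  ext ⟨j, x⟩
  by_cases hj : j = e
  · subst hj; simp [Set.indicator]
  · simp [Set.indicator, hj]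

open Classical in
theorem integrable_fiber {h : ℝ → ℝ} {e : E} (hh : IntegrableOn h (G.openEdge e)) :
    Integrable (fun s : Σ _ : E, ℝ => if s.1 = e then h s.2 else 0) G.edgeMeasure := by
  rw [fiber_eq_indicator,
    integrable_indicator_iff (measurableEmbedding_sigmaMk e).measurableSet_range, IntegrableOn,
    restrict_edgeMeasure, (measurableEmbedding_sigmaMk e).integrable_map_iff]
  exact hh

open Classical in
theorem integral_fiber (h : ℝ → ℝ) (e : E) :
    ∫ s, (if s.1 = e then h s.2 else 0) ∂G.edgeMeasure = ∫ x in G.openEdge e, h x := by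
  rw [fiber_eq_indicator,
    integral_indicator (measurableEmbedding_sigmaMk e).measurableSet_range,
    restrict_edgeMeasure, (measurableEmbedding_sigmaMk e).integral_map]

theorem eLpPow_eq_lintegral (q : ℝ) (f : E → ℝ → ℝ) :
    G.eLpPow q f = ∫⁻ s, ‖f s.1 s.2‖ₑ ^ q ∂G.edgeMeasure :=
  (lintegral_edgeMeasure fun s : Σ _ : E, ℝ => ‖f s.1 s.2‖ₑ ^ q).symm

theorem measurable_uncurry {f : E → ℝ → ℝ} (hf : ∀ e, Measurable (f e)) :
    Measurable fun s : Σ _ : E, ℝ => f s.1 s.2 :=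
  measurable_sigma hf

theorem eLpPow_lt_top_iff {q : ℝ} (hq : 0 < q) {f : E → ℝ → ℝ} (hf : ∀ e, Measurable (f e)) :
    G.eLpPow q f < ⊤ ↔
      MemLp (fun s : Σ _ : E, ℝ => f s.1 s.2) (ENNReal.ofReal q) G.edgeMeasure := by
  rw [MemLp, and_iff_right (measurable_uncurry hf).aestronglyMeasurable,
    eLpNorm_lt_top_iff_lintegral_rpow_enorm_lt_top (by simpa using hq) ENNReal.ofReal_ne_top,
    ENNReal.toReal_ofReal hq.le, eLpPow_eq_lintegral]

theorem lpPow_two_eq_integral {f : E → ℝ → ℝ} (hf : ∀ e, Measurable (f e)) :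
    G.lpPow 2 f = ∫ s, f s.1 s.2 ^ 2 ∂G.edgeMeasure := by
  rw [integral_eq_lintegral_of_nonneg_ae (Filter.Eventually.of_forall fun s => sq_nonneg _)
    ((measurable_uncurry hf).pow_const 2).aestronglyMeasurable, lpPow, eLpPow_eq_lintegral]
  congr 1
  refine lintegral_congr fun s => ?_
  rw [← sq_abs, ENNReal.ofReal_pow (abs_nonneg _), ← Real.enorm_eq_ofReal_abs]
  exact ENNReal.rpow_two _

theorem eLpPow_congr {q : ℝ} {f g : E → ℝ → ℝ}
    (h : ∀ e, ∀ᵐ x : ℝ, x ∈ G.openEdge e → f e x = g e x) : G.eLpPow q f = G.eLpPow q g := by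
  refine tsum_congr fun e => setLIntegral_congr_fun_ae (G.measurableSet_openEdge e) ?_
  filter_upwards [h e] with x hx hxe
  rw [hx hxe]

theorem eLpPow_mono {q : ℝ} (hq : 0 ≤ q) {f g : E → ℝ → ℝ} (h : ∀ e x, |f e x| ≤ |g e x|) :
    G.eLpPow q f ≤ G.eLpPow q g := by
  refine ENNReal.tsum_le_tsum fun e => lintegral_mono fun x => ?_
  refine ENNReal.rpow_le_rpow ?_ hq
  rw [Real.enorm_eq_ofReal_abs, Real.enorm_eq_ofReal_abs]
  exact ENNReal.ofReal_le_ofReal (h e x)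

/-- For a function split into two parts at least one of which vanishes at almost every point: `u`
into `u⁺`, `u⁻`, and likewise `u'`. -/
theorem eLpPow_eq_add {q : ℝ} (hq : 0 < q) {f g h : E → ℝ → ℝ} (hg : ∀ e, Measurable (g e))
    (H : ∀ e, ∀ᵐ x : ℝ, (f e x = g e x ∧ h e x = 0) ∨ (f e x = h e x ∧ g e x = 0)) :
    G.eLpPow q f = G.eLpPow q g + G.eLpPow q h := by
  rw [eLpPow, eLpPow, eLpPow, ← ENNReal.tsum_add]
  refine tsum_congr fun e => ?_
  rw [← lintegral_add_left ((hg e).enorm.pow_const q)]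
  refine lintegral_congr_ae (ae_restrict_of_ae ?_)
  filter_upwards [H e] with x hx
  rcases hx with ⟨h1, h2⟩ | ⟨h1, h2⟩ <;> simp [h1, h2, hq]

theorem eLpPow_const_mul {q : ℝ} (hq : 0 < q) {s : ℝ} (hs : 0 ≤ s) (f : E → ℝ → ℝ) :
    G.eLpPow q (fun e x => s * f e x) = ENNReal.ofReal (s ^ q) * G.eLpPow q f := by
  rw [eLpPow, eLpPow, ← ENNReal.tsum_mul_left]
  refine tsum_congr fun e => ?_
  rw [← lintegral_const_mul' _ _ ENNReal.ofReal_ne_top]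
  refine lintegral_congr fun x => ?_
  rw [enorm_mul, ENNReal.mul_rpow_of_nonneg _ _ hq.le, Real.enorm_eq_ofReal_abs s, abs_of_nonneg hs,
    ENNReal.ofReal_rpow_of_nonneg hs hq.le]

theorem lpPow_const_mul {q : ℝ} (hq : 0 < q) {s : ℝ} (hs : 0 ≤ s) (f : E → ℝ → ℝ) :
    G.lpPow q (fun e x => s * f e x) = s ^ q * G.lpPow q f := by
  rw [lpPow, eLpPow_const_mul hq hs, ENNReal.toReal_mul,
    ENNReal.toReal_ofReal (Real.rpow_nonneg hs q), lpPow]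

theorem lpPow_two_add_mul {f g : E → ℝ → ℝ} (hf : ∀ e, Measurable (f e))
    (hg : ∀ e, Measurable (g e)) (hf2 : G.eLpPow 2 f < ⊤) (hg2 : G.eLpPow 2 g < ⊤) (t : ℝ) :
    G.lpPow 2 (fun e x => f e x + t * g e x) = G.lpPow 2 f +
      2 * t * ∫ s, f s.1 s.2 * g s.1 s.2 ∂G.edgeMeasure + t ^ 2 * G.lpPow 2 g := by
  rw [eLpPow_lt_top_iff two_pos hf, ENNReal.ofReal_ofNat] at hf2
  rw [eLpPow_lt_top_iff two_pos hg, ENNReal.ofReal_ofNat] at hg2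
  have hfg : Integrable (fun s : Σ _ : E, ℝ => f s.1 s.2 * g s.1 s.2) G.edgeMeasure :=
    hf2.integrable_mul hg2
  rw [lpPow_two_eq_integral hf, lpPow_two_eq_integral hg,
    lpPow_two_eq_integral (f := fun e x => f e x + t * g e x)
      fun e => (hf e).add ((hg e).const_mul t),
    ← integral_const_mul, ← integral_const_mul, ← integral_add hf2.integrable_sq
      (hfg.const_mul _), ← integral_add _ (hg2.integrable_sq.const_mul _)]
  · congr 1; ext s; ring
  · exact hf2.integrable_sq.add (hfg.const_mul _)

/-! ### Linear combinations in `H¹` and the quadratic form -/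

theorem H1.measurable_restr {u : G.Point → ℝ} (hu : u ∈ G.H1) (e : E) :
    Measurable (G.restr u e) :=
  (H1.continuous_restr hu e).measurable

theorem H1.derivative_add_mul {u v : G.Point → ℝ} (hu : u ∈ G.H1) (hv : v ∈ G.H1) (t : ℝ) (e : E) :
    ∀ᵐ x : ℝ, G.derivative (fun y => u y + t * v y) e x =
      G.derivative u e x + t * G.derivative v e x := by
  filter_upwards [H1.ae_differentiableAt_restr hu e, H1.ae_differentiableAt_restr hv e]
    with x hx hx'
  exact (hx.hasDerivAt.add (hx'.hasDerivAt.const_mul t)).deriv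

theorem eLpPow_two_add_mul_lt_top {f g : E → ℝ → ℝ} (hf : ∀ e, Measurable (f e))
    (hg : ∀ e, Measurable (g e)) {q : ℝ} (hq : 0 < q) (hf2 : G.eLpPow q f < ⊤)
    (hg2 : G.eLpPow q g < ⊤) (t : ℝ) : G.eLpPow q (fun e x => f e x + t * g e x) < ⊤ := by
  rw [eLpPow_lt_top_iff (f := fun e x => f e x + t * g e x) hq
    fun e => (hf e).add ((hg e).const_mul t)]
  rw [eLpPow_lt_top_iff hq hf] at hf2
  rw [eLpPow_lt_top_iff hq hg] at hg2
  exact hf2.add (hg2.const_mul t)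

theorem H1.add_mul {u v : G.Point → ℝ} (hu : u ∈ G.H1) (hv : v ∈ G.H1) (t : ℝ) :
    (fun y => u y + t * v y) ∈ G.H1 := by
  refine ⟨fun e a b ha hab hb => (hu.1 e a b ha hab hb).add ((hv.1 e a b ha hab hb).const_mul t),
    eLpPow_two_add_mul_lt_top (H1.measurable_restr hu) (H1.measurable_restr hv) two_pos
      hu.2.1 hv.2.1 t, ?_⟩
  rw [eLpPow_congr fun e => (H1.derivative_add_mul hu hv t e).mono fun x hx _ => hx]
  exact eLpPow_two_add_mul_lt_top (measurable_derivative u) (measurable_derivative v) two_pos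
    hu.2.2 hv.2.2 t

theorem derivative_const_mul (s : ℝ) (u : G.Point → ℝ) :
    G.derivative (fun y => s * u y) = fun e x => s * G.derivative u e x := by
  ext e x
  exact deriv_const_mul_field s

theorem H1Z.const_mul {Z : Set V} {u : G.Point → ℝ} (hu : u ∈ G.H1Z Z) {s : ℝ} (hs : 0 ≤ s) :
    (fun y => s * u y) ∈ G.H1Z Z := by
  refine ⟨⟨fun e a b ha hab hb => (hu.1.1 e a b ha hab hb).const_mul s, ?_, ?_⟩,
    fun v hv => by simp [hu.2 v hv]⟩
  · exact (eLpPow_const_mul two_pos hs (G.restr u)).trans_lt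
      (ENNReal.mul_lt_top ENNReal.ofReal_lt_top hu.1.2.1)
  · rw [derivative_const_mul, eLpPow_const_mul two_pos hs]
    exact ENNReal.mul_lt_top ENNReal.ofReal_lt_top hu.1.2.2

theorem H1Z.add_mul {Z : Set V} {u v : G.Point → ℝ} (hu : u ∈ G.H1Z Z) (hv : v ∈ G.H1Z Z) (t : ℝ) :
    (fun y => u y + t * v y) ∈ G.H1Z Z :=
  ⟨H1.add_mul hu.1 hv.1 t, fun z hz => by simp [hu.2 z hz, hv.2 z hz]⟩

variable (G) in
/-- The quadratic form `‖u'‖₂² + λ ‖u‖₂²`. -/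
noncomputable def quadForm (lam : ℝ) (u : G.Point → ℝ) : ℝ :=
  G.lpPow 2 (G.derivative u) + lam * G.lpPow 2 (G.restr u)

variable (G) in
/-- The bilinear form associated with `quadForm`. -/
noncomputable def bilinForm (lam : ℝ) (u v : G.Point → ℝ) : ℝ :=
  ∫ s, G.derivative u s.1 s.2 * G.derivative v s.1 s.2 ∂G.edgeMeasure +
    lam * ∫ s, G.restr u s.1 s.2 * G.restr v s.1 s.2 ∂G.edgeMeasure

theorem quadForm_add_mul {lam : ℝ} {u v : G.Point → ℝ} (hu : u ∈ G.H1) (hv : v ∈ G.H1) (t : ℝ) :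
    G.quadForm lam (fun y => u y + t * v y) =
      G.quadForm lam u + 2 * t * G.bilinForm lam u v + t ^ 2 * G.quadForm lam v := by
  have h1 : G.lpPow 2 (G.derivative fun y => u y + t * v y) =
      G.lpPow 2 fun e x => G.derivative u e x + t * G.derivative v e x :=
    congrArg ENNReal.toReal
      (eLpPow_congr fun e => (H1.derivative_add_mul hu hv t e).mono fun x hx _ => hx)
  have h2 : G.lpPow 2 (G.restr fun y => u y + t * v y) = _ :=
    lpPow_two_add_mul (H1.measurable_restr hu) (H1.measurable_restr hv) hu.2.1 hv.2.1 t
  rw [lpPow_two_add_mul (measurable_derivative u) (measurable_derivative v) hu.2.2 hv.2.2 t] at h1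
  simp only [quadForm, bilinForm, h1, h2]
  ring

theorem quadForm_const_mul {lam s : ℝ} (hs : 0 ≤ s) (u : G.Point → ℝ) :
    G.quadForm lam (fun y => s * u y) = s ^ 2 * G.quadForm lam u := by
  have h : G.lpPow 2 (G.restr fun y => s * u y) = _ := lpPow_const_mul two_pos hs (G.restr u)
  rw [quadForm, h, derivative_const_mul, lpPow_const_mul two_pos hs, quadForm, Real.rpow_two]
  ring

/-! ### Nonzero functions and positivity of the quadratic form -/

theorem H1.eqOn_zero_of_openEdge {u : G.Point → ℝ} (hu : u ∈ G.H1) {e : E}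
    (h : ∀ x ∈ G.openEdge e, G.restr u e x = 0) :
    u (.vertex (G.tail e)) = 0 ∧ ∀ he, u (.vertex (G.head e he)) = 0 := by
  have hcl : Set.EqOn (G.restr u e) (fun _ => 0) (closure (G.openEdge e)) :=
    Set.EqOn.closure h (H1.continuous_restr hu e) continuous_const
  have h0 : (0 : ℝ) ∈ closure (G.openEdge e) := by
    by_cases ht : G.len e = ⊤
    · rw [G.openEdge_of_eq_top e ht, closure_Ioi]; simp
    · rw [G.openEdge_of_ne_top e ht, closure_Ioo (G.toReal_len_pos e ht).ne]; simp
  refine ⟨?_, fun he => ?_⟩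
  · have := hcl h0
    rwa [restr, G.pt_of_nonpos e le_rfl] at this
  · have h1 : (G.len e).toReal ∈ closure (G.openEdge e) := by
      rw [G.openEdge_of_ne_top e he, closure_Ioo (G.toReal_len_pos e he).ne]; simp
    have := hcl h1
    rwa [restr, G.pt_toReal_len e he] at this

variable (G) in
/-- The edge `e` is incident at the vertex `v`. -/
def Incident (e : E) (v : V) : Prop := G.tail e = v ∨ ∃ h, G.head e h = v

theorem IsNoncompact.nonempty_edges (hnc : G.IsNoncompact) : Nonempty E := by
  rcases hnc with ⟨e, _⟩ | h
  · exact ⟨e⟩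
  · infer_instance

theorem adjacency_adj {v w : V} (h : G.adjacency.Adj v w) :
    ∃ e, G.Incident e v ∧ G.Incident e w := by
  rw [adjacency, SimpleGraph.fromRel_adj] at h
  obtain ⟨-, ⟨e, he, h1, h2⟩ | ⟨e, he, h1, h2⟩⟩ := h
  · exact ⟨e, .inl h1, .inr ⟨he, h2⟩⟩
  · exact ⟨e, .inr ⟨he, h2⟩, .inl h1⟩

theorem IsInClassG.exists_incident (hG : G.IsInClassG) (hne : Nonempty E) (v : V) :
    ∃ e, G.Incident e v := by
  obtain ⟨e⟩ := hne
  obtain ⟨p⟩ := hG.connected.preconnected v (G.tail e)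
  cases p with
  | nil => exact ⟨e, .inl rfl⟩
  | cons h _ => exact (adjacency_adj h).imp fun _ h => h.1

theorem H1.exists_ne_zero {u : G.Point → ℝ} (hu : u ∈ G.H1) (hG : G.IsInClassG)
    (hne : Nonempty E) (h0 : u ≠ 0) : ∃ e, ∃ x ∈ G.openEdge e, G.restr u e x ≠ 0 := by
  by_contra! h
  refine h0 (funext fun y => ?_)
  cases y with
  | vertex v =>
    obtain ⟨e, rfl | ⟨he, rfl⟩⟩ := hG.exists_incident hne v
    · exact (H1.eqOn_zero_of_openEdge hu (h e)).1
    · exact (H1.eqOn_zero_of_openEdge hu (h e)).2 he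
  | interior e x h1 h2 =>
    have := h e x ⟨h1, h2⟩
    rwa [restr, G.pt_of_mem_openEdge e ⟨h1, h2⟩] at this

theorem H1.lpPow_two_pos {u : G.Point → ℝ} (hu : u ∈ G.H1) (hG : G.IsInClassG)
    (hne : Nonempty E) (h0 : u ≠ 0) : 0 < G.lpPow 2 (G.restr u) := by
  obtain ⟨e, x, hx, hne⟩ := H1.exists_ne_zero hu hG hne h0
  refine ENNReal.toReal_pos (fun h => ?_) hu.2.1.ne
  have h1 := ENNReal.tsum_eq_zero.1 h e
  rw [lintegral_eq_zero_iff ((H1.measurable_restr hu e).enorm.pow_const _), Filter.EventuallyEq,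
    ae_restrict_iff' (G.measurableSet_openEdge e)] at h1
  have ho : IsOpen (G.openEdge e ∩ {x | G.restr u e x ≠ 0}) :=
    (G.isOpen_openEdge e).inter (isOpen_ne_fun (H1.continuous_restr hu e) continuous_const)
  have hz : volume (G.openEdge e ∩ {x | G.restr u e x ≠ 0}) = 0 := by
    refine measure_mono_null (fun y hy => ?_) h1
    simp only [Set.mem_compl_iff, Set.mem_ofPred_eq, not_forall]
    exact ⟨hy.1, fun h => hy.2 (by simpa using h)⟩
  exact Set.eq_empty_iff_forall_notMem.1 ((ho.measure_eq_zero_iff volume).1 hz) x ⟨hx, hne⟩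

theorem H1Z.quadForm_pos {Z : Set V} {lam : ℝ} (hlam : -G.omega Z < (lam : EReal))
    {u : G.Point → ℝ} (hu : u ∈ G.H1Z Z) (hG : G.IsInClassG)
    (hne : Nonempty E) (h0 : u ≠ 0) : 0 < G.quadForm lam u := by
  have hN := H1.lpPow_two_pos hu.1 hG hne h0
  have h1 : G.omega Z ≤ ((G.lpPow 2 (G.derivative u) / G.lpPow 2 (G.restr u) : ℝ) : EReal) :=
    iInf₂_le u ⟨hu, h0⟩
  have h2 : ((-lam : ℝ) : EReal) < G.omega Z := by
    rw [EReal.coe_neg]; exact EReal.neg_lt_comm.1 hlam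
  have h3 := EReal.coe_lt_coe_iff.1 (h2.trans_le h1)
  rw [lt_div_iff₀ hN] at h3
  rw [quadForm]; linarith

/-! ### The Nehari manifold and its minimizers -/

theorem action_eq_of_mem_nehari {p lam : ℝ} {Z : Set V} {u : G.Point → ℝ}
    (hu : u ∈ G.nehari p lam Z) : G.action p lam u = (1 / 2 - 1 / p) * G.quadForm lam u := by
  have := hu.2.2
  rw [action, ← this, quadForm]
  ring

/-- `lpPow` gives an infinite norm the value `0`; the Nehari identity excludes this, its other side
being positive. -/
theorem nehari.eLpPow_lt_top {p lam : ℝ} {Z : Set V} (hlam : -G.omega Z < (lam : EReal))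
    (hG : G.IsInClassG) (hne : Nonempty E) {u : G.Point → ℝ} (hu : u ∈ G.nehari p lam Z) :
    G.eLpPow p (G.restr u) < ⊤ := by
  have h1 := H1Z.quadForm_pos hlam hu.1 hG hne hu.2.1
  rw [quadForm, hu.2.2] at h1
  exact (ENNReal.toReal_pos_iff.1 h1).2

/-- Where `u ≤ 0`, the function `max u 0` attains its minimum `0`, so its derivative vanishes there;
where `u ≥ 0`, the same holds for the maximum of `min u 0`. -/
theorem derivative_max_min {u : G.Point → ℝ} (h1 : (fun y => max (u y) 0) ∈ G.H1)
    (h2 : (fun y => min (u y) 0) ∈ G.H1) (e : E) : ∀ᵐ x : ℝ,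
      (G.derivative u e x = G.derivative (fun y => max (u y) 0) e x ∧
        G.derivative (fun y => min (u y) 0) e x = 0) ∨
      (G.derivative u e x = G.derivative (fun y => min (u y) 0) e x ∧
        G.derivative (fun y => max (u y) 0) e x = 0) := by
  filter_upwards [H1.ae_differentiableAt_restr h1 e, H1.ae_differentiableAt_restr h2 e]
    with x hx hx'
  have hadd : G.derivative u e x = G.derivative (fun y => max (u y) 0) e x +
      G.derivative (fun y => min (u y) 0) e x := by
    have := (hx.hasDerivAt.add hx'.hasDerivAt).deriv
    rw [derivative, derivative, derivative, ← this]
    congr 1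
    ext z
    simp [restr, max_add_min]
  rcases le_total (G.restr u e x) 0 with h | h
  · right
    have h0 : G.derivative (fun y => max (u y) 0) e x = 0 := by
      refine IsLocalMin.deriv_eq_zero (Filter.Eventually.of_forall fun z => ?_)
      simp only [restr] at h ⊢
      rw [max_eq_right h]; exact le_max_right _ _
    exact ⟨by rw [hadd, h0, zero_add], h0⟩
  · left
    have h0 : G.derivative (fun y => min (u y) 0) e x = 0 := by
      refine IsLocalMax.deriv_eq_zero (Filter.Eventually.of_forall fun z => ?_)
      simp only [restr] at h ⊢
      rw [min_eq_right h]; exact min_le_right _ _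
    exact ⟨by rw [hadd, h0, add_zero], h0⟩

theorem action_eq_add {p lam : ℝ} {Z : Set V} (hp : 0 < p) (hlam : -G.omega Z < (lam : EReal))
    (hG : G.IsInClassG) (hne : Nonempty E) {u : G.Point → ℝ} (hu : u ∈ G.nodalNehari p lam Z) :
    G.action p lam u = G.action p lam (fun y => max (u y) 0) +
      G.action p lam (fun y => min (u y) 0) := by
  obtain ⟨-, h1, h2⟩ := hu
  have hd : G.lpPow 2 (G.derivative u) = G.lpPow 2 (G.derivative fun y => max (u y) 0) +
      G.lpPow 2 (G.derivative fun y => min (u y) 0) := by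
    rw [lpPow, eLpPow_eq_add two_pos (measurable_derivative _)
      (derivative_max_min h1.1.1 h2.1.1), ENNReal.toReal_add h1.1.1.2.2.ne h2.1.1.2.2.ne]
    rfl
  have hr : ∀ q : ℝ, 0 < q → G.eLpPow q (G.restr fun y => max (u y) 0) ≠ ⊤ →
      G.eLpPow q (G.restr fun y => min (u y) 0) ≠ ⊤ →
      G.lpPow q (G.restr u) = G.lpPow q (G.restr fun y => max (u y) 0) +
        G.lpPow q (G.restr fun y => min (u y) 0) := by
    intro q hq hq1 hq2
    rw [lpPow, eLpPow_eq_add hq (H1.measurable_restr h1.1.1) fun e =>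
      Filter.Eventually.of_forall fun x => ?_, ENNReal.toReal_add hq1 hq2]
    · rfl
    · rcases le_total (G.restr u e x) 0 with h | h
      · right; simp only [restr] at h ⊢; simp [h]
      · left; simp only [restr] at h ⊢; simp [h]
  rw [action, action, action, hd, hr 2 two_pos h1.1.1.2.1.ne h2.1.1.2.1.ne,
    hr p hp (nehari.eLpPow_lt_top hlam hG hne h1).ne (nehari.eLpPow_lt_top hlam hG hne h2).ne]
  ring

/-- A minimizer of the action on the Nehari manifold minimizes the quadratic form among the
functions whose `L^p` norm is at least its own. -/
theorem quadForm_le_of_minimizer {p lam : ℝ} {Z : Set V} (hp : 2 < p)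
    (hlam : -G.omega Z < (lam : EReal)) (hG : G.IsInClassG) (hne : Nonempty E)
    {w : G.Point → ℝ} (hw : w ∈ G.nehari p lam Z)
    (hmin : ∀ v ∈ G.nehari p lam Z, G.action p lam w ≤ G.action p lam v)
    {v : G.Point → ℝ} (hv : v ∈ G.H1Z Z) (h : G.lpPow p (G.restr w) ≤ G.lpPow p (G.restr v)) :
    G.quadForm lam w ≤ G.quadForm lam v := by
  by_contra! hlt
  have hp0 : 0 < p := by linarith
  have hQw := H1Z.quadForm_pos hlam hw.1 hG hne hw.2.1
  have hPw : G.quadForm lam w = G.lpPow p (G.restr w) := hw.2.2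
  have hPv : 0 < G.lpPow p (G.restr v) := by linarith
  have hv0 : v ≠ 0 := by
    rintro rfl
    have : G.lpPow p (G.restr (0 : G.Point → ℝ)) = 0 := by
      simp [lpPow, eLpPow, restr, hp0]
    linarith
  have hQv := H1Z.quadForm_pos hlam hv hG hne hv0
  -- `s = r^(1/(p-2))` is the factor that puts `s v` on the Nehari manifold. Here `r < 1`, hence `s
  -- < 1`, and the quadratic form of `s v` is below that of `w`, against minimality.
  set r := G.quadForm lam v / G.lpPow p (G.restr v) with hr
  have hr0 : 0 < r := div_pos hQv hPv
  have hr1 : r < 1 := (div_lt_one hPv).2 (by linarith)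
  set s := r ^ (1 / (p - 2)) with hs
  have hs0 : 0 < s := Real.rpow_pos_of_pos hr0 _
  have hs1 : s < 1 := Real.rpow_lt_one hr0.le hr1 (by apply one_div_pos.2; linarith)
  have hsp : s ^ p = s ^ 2 * r := by
    have : s ^ (p - 2) = r := by
      rw [hs, ← Real.rpow_mul hr0.le, one_div_mul_cancel (by linarith), Real.rpow_one]
    rw [← this, ← Real.rpow_two, ← Real.rpow_add hs0]
    ring_nf
  have hmem : (fun y => s * v y) ∈ G.nehari p lam Z := by
    refine ⟨H1Z.const_mul hv hs0.le, fun h0 => hv0 (funext fun y => ?_), ?_⟩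
    · have := congrFun h0 y
      simpa [hs0.ne'] using this
    · have h1 : G.lpPow p (G.restr fun y => s * v y) = _ := lpPow_const_mul hp0 hs0.le (G.restr v)
      have h2 := quadForm_const_mul (lam := lam) hs0.le v
      rw [h1, hsp, mul_assoc, hr, div_mul_cancel₀ _ hPv.ne', ← h2, quadForm]
  have hle := hmin _ hmem
  rw [action_eq_of_mem_nehari hw, action_eq_of_mem_nehari hmem,
    quadForm_const_mul hs0.le] at hle
  have hc : 0 < 1 / 2 - 1 / p := by
    have : 1 / p < 1 / 2 := one_div_lt_one_div_of_lt two_pos hp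
    linarith
  have h2 := le_of_mul_le_mul_left hle hc
  have h3 : s ^ 2 * G.quadForm lam v ≤ G.quadForm lam v :=
    mul_le_of_le_one_left hQv.le (pow_le_one₀ hs0.le hs1.le)
  linarith

/-- A nonnegative minimizer of the action on the Nehari manifold is a weak supersolution of
`-w'' + λ w = 0`. -/
theorem bilinForm_nonneg_of_minimizer {p lam : ℝ} {Z : Set V} (hp : 2 < p)
    (hlam : -G.omega Z < (lam : EReal)) (hG : G.IsInClassG) (hne : Nonempty E)
    {w : G.Point → ℝ} (hw : w ∈ G.nehari p lam Z) (hw0 : ∀ y, 0 ≤ w y)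
    (hmin : ∀ v ∈ G.nehari p lam Z, G.action p lam w ≤ G.action p lam v)
    {φ : G.Point → ℝ} (hφ : φ ∈ G.H1Z Z) (hφ0 : ∀ y, 0 ≤ φ y)
    (hφp : G.eLpPow p (G.restr φ) < ⊤) : 0 ≤ G.bilinForm lam w φ := by
  have hp0 : 0 < p := by linarith
  have key : ∀ t > 0, 0 ≤ 2 * G.bilinForm lam w φ + t * G.quadForm lam φ := by
    intro t ht
    have h1 : G.quadForm lam w ≤ G.quadForm lam fun y => w y + t * φ y := by
      refine quadForm_le_of_minimizer hp hlam hG hne hw hmin (H1Z.add_mul hw.1 hφ t) ?_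
      refine ENNReal.toReal_mono (eLpPow_two_add_mul_lt_top (H1.measurable_restr hw.1.1)
        (H1.measurable_restr hφ.1) hp0 (nehari.eLpPow_lt_top hlam hG hne hw) hφp t).ne
        (eLpPow_mono hp0.le fun e x => abs_le_abs_of_nonneg (hw0 _) ?_)
      exact le_add_of_nonneg_right (mul_nonneg ht.le (hφ0 _))
    rw [quadForm_add_mul hw.1.1 hφ.1] at h1
    have : 0 ≤ t * (2 * G.bilinForm lam w φ + t * G.quadForm lam φ) := by linarith
    exact nonneg_of_mul_nonneg_right this ht
  by_contra! hneg
  have hq : 0 < |G.quadForm lam φ| + 1 := by positivity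
  -- With this `t`, the quadratic term cancels at most half of the negative quantity `2 *
  -- G.bilinForm lam w φ`.
  have := key (-G.bilinForm lam w φ / (|G.quadForm lam φ| + 1)) (div_pos (by linarith) hq)
  have h2 : -G.bilinForm lam w φ / (|G.quadForm lam φ| + 1) * G.quadForm lam φ ≤
      -G.bilinForm lam w φ := by
    rw [div_mul_eq_mul_div, div_le_iff₀ hq]
    refine mul_le_mul_of_nonneg_left ?_ (by linarith)
    linarith [le_abs_self (G.quadForm lam φ)]
  linarith

end MetricGraph

/-! ### Tent functions on the line -/

/-- The tent function of height and half-width `ε` centred at `c`. -/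
noncomputable def tent (c ε x : ℝ) : ℝ := max 0 (ε - |x - c|)

/-- The derivative of the tent function. -/
noncomputable def tentDeriv (c ε x : ℝ) : ℝ :=
  (Set.Ioc (c - ε) c).indicator 1 x - (Set.Ioc c (c + ε)).indicator 1 x

theorem tent_nonneg (c ε x : ℝ) : 0 ≤ tent c ε x := le_max_left _ _

theorem tent_le {ε : ℝ} (hε : 0 ≤ ε) (c x : ℝ) : tent c ε x ≤ ε :=
  max_le hε (by linarith [abs_nonneg (x - c)])

theorem tent_eq_zero {c ε x : ℝ} (h : ε ≤ |x - c|) : tent c ε x = 0 := max_eq_left (by linarith)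

theorem tent_self {ε : ℝ} (hε : 0 ≤ ε) (c : ℝ) : tent c ε c = ε := by simp [tent, hε]

theorem continuous_tent (c ε : ℝ) : Continuous (tent c ε) := by
  unfold tent; fun_prop

theorem lipschitzWith_tent (c ε : ℝ) : LipschitzWith 1 (tent c ε) := by
  refine LipschitzWith.of_dist_le_mul fun x y => ?_
  rw [Real.dist_eq, Real.dist_eq, NNReal.coe_one, one_mul, tent, tent]
  grind

theorem hasDerivAt_tent {c ε x : ℝ} (h1 : x ≠ c - ε) (h2 : x ≠ c) (h3 : x ≠ c + ε)
    (hε : 0 < ε) : HasDerivAt (tent c ε) (tentDeriv c ε x) x := by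
  rcases lt_or_gt_of_ne h1 with h1 | h1
  · have hd : tentDeriv c ε x = 0 := by
      simp only [tentDeriv, Set.indicator, Set.mem_Ioc]; grind
    rw [hd]
    refine (hasDerivAt_const x 0).congr_of_eventuallyEq ?_
    filter_upwards [Iio_mem_nhds h1] with y hy
    simp only [Set.mem_Iio] at hy
    exact tent_eq_zero (by grind)
  rcases lt_or_gt_of_ne h2 with h2 | h2
  · have hd : tentDeriv c ε x = 1 := by
      simp only [tentDeriv, Set.indicator, Set.mem_Ioc, Pi.one_apply]; grind
    rw [hd]
    refine ((hasDerivAt_id x).add_const (ε - c)).congr_of_eventuallyEq ?_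
    filter_upwards [Ioo_mem_nhds h1 h2] with y hy
    simp only [Set.mem_Ioo] at hy
    simp only [tent, id]; grind
  rcases lt_or_gt_of_ne h3 with h3 | h3
  · have hd : tentDeriv c ε x = -1 := by
      simp only [tentDeriv, Set.indicator, Set.mem_Ioc, Pi.one_apply]; grind
    rw [hd]
    refine ((hasDerivAt_id x).const_sub (ε + c)).congr_of_eventuallyEq ?_
    filter_upwards [Ioo_mem_nhds h2 h3] with y hy
    simp only [Set.mem_Ioo] at hy
    simp only [tent, id]; grind
  · have hd : tentDeriv c ε x = 0 := by
      simp only [tentDeriv, Set.indicator, Set.mem_Ioc]; grind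
    rw [hd]
    refine (hasDerivAt_const x 0).congr_of_eventuallyEq ?_
    filter_upwards [Ioi_mem_nhds h3] with y hy
    simp only [Set.mem_Ioi] at hy
    exact tent_eq_zero (by grind)

theorem memLp_tent (c ε : ℝ) (q : ℝ≥0∞) : MemLp (tent c ε) q := by
  refine (continuous_tent c ε).memLp_of_hasCompactSupport ?_
  refine HasCompactSupport.intro (isCompact_Icc (a := c - ε) (b := c + ε)) fun x hx => ?_
  refine tent_eq_zero ?_
  simp only [Set.mem_Icc] at hx
  grind

theorem memLp_tentDeriv (c ε : ℝ) (q : ℝ≥0∞) : MemLp (tentDeriv c ε) q :=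
  (memLp_indicator_const q measurableSet_Ioc 1 (.inr (by simp))).sub
    (memLp_indicator_const q measurableSet_Ioc 1 (.inr (by simp)))

theorem AbsolutelyContinuousOnInterval.sum {ι : Type*} (s : Finset ι) {f : ι → ℝ → ℝ} {a b : ℝ}
    (h : ∀ i ∈ s, AbsolutelyContinuousOnInterval (f i) a b) :
    AbsolutelyContinuousOnInterval (∑ i ∈ s, f i) a b := by
  refine Finset.sum_induction f (fun g => AbsolutelyContinuousOnInterval g a b)
    (fun _ _ => AbsolutelyContinuousOnInterval.add) ?_ h
  exact ((LipschitzWith.const (0 : ℝ)).lipschitzOnWith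
    (s := Set.uIcc a b)).absolutelyContinuousOnInterval

/-! ### Tents on the graph as test functions -/

namespace MetricGraph

variable {V E : Type*} {G : MetricGraph V E}

open Classical in
theorem memLp_fiber {h : ℝ → ℝ} {q : ℝ≥0∞} (hh : MemLp h q) (e : E) :
    MemLp (fun s : Σ _ : E, ℝ => if s.1 = e then h s.2 else 0) q G.edgeMeasure := by
  rw [fiber_eq_indicator,
    memLp_indicator_iff_restrict (measurableEmbedding_sigmaMk e).measurableSet_range,
    restrict_edgeMeasure, (measurableEmbedding_sigmaMk e).memLp_map_measure_iff]
  exact hh.restrict _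

section tents

variable {ι : Type*} [Fintype ι]

open Classical in
/-- A sum of tents `tent (c i) ε` carried by the edges `a i`, edge by edge. -/
noncomputable def tentSum (a : ι → E) (c : ι → ℝ) (ε : ℝ) (e : E) (x : ℝ) : ℝ :=
  ∑ i, if e = a i then tent (c i) ε x else 0

open Classical in
/-- The derivative of `tentSum`. -/
noncomputable def tentSumDeriv (a : ι → E) (c : ι → ℝ) (ε : ℝ) (e : E) (x : ℝ) : ℝ :=
  ∑ i, if e = a i then tentDeriv (c i) ε x else 0

variable (G) in
/-- The function on the graph given by `tentSum` on the edges, and by `g` on the vertices. -/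
noncomputable def tentFun (g : V → ℝ) (a : ι → E) (c : ι → ℝ) (ε : ℝ) : G.Point → ℝ
  | .vertex v => g v
  | .interior e x _ _ => tentSum a c ε e x

variable {a : ι → E} {c : ι → ℝ} {ε : ℝ} {g : V → ℝ}

theorem tentSum_nonneg (e : E) (x : ℝ) : 0 ≤ tentSum a c ε e x :=
  Finset.sum_nonneg fun i _ => by split_ifs; exacts [tent_nonneg _ _ _, le_rfl]

theorem tentFun_nonneg (hg : ∀ v, 0 ≤ g v) (y : G.Point) : 0 ≤ G.tentFun g a c ε y := by
  cases y with
  | vertex v => exact hg v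
  | interior e x _ _ => exact tentSum_nonneg e x

variable (G) in
/-- The values `g` at the vertices are those of `tentSum` at the ends of the edges. -/
def TentCompat (g : V → ℝ) (a : ι → E) (c : ι → ℝ) (ε : ℝ) : Prop :=
  (∀ e, tentSum a c ε e 0 = g (G.tail e)) ∧
    ∀ e h, tentSum a c ε e (G.len e).toReal = g (G.head e h)

theorem restr_tentFun_of_mem_openEdge {e : E} {x : ℝ} (hx : x ∈ G.openEdge e) :
    G.restr (G.tentFun g a c ε) e x = tentSum a c ε e x := by
  rw [restr, G.pt_of_mem_openEdge e hx, tentFun]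

theorem TentCompat.restr_eq (h : G.TentCompat g a c ε) {e : E} {x : ℝ} (hx : 0 ≤ x)
    (hxl : ENNReal.ofReal x ≤ G.len e) :
    G.restr (G.tentFun g a c ε) e x = tentSum a c ε e x := by
  rcases hx.eq_or_lt with rfl | hx
  · rw [restr, G.pt_of_nonpos e le_rfl, tentFun, h.1]
  rcases hxl.eq_or_lt with hl | hl
  · have ht : G.len e ≠ ⊤ := hl ▸ ENNReal.ofReal_ne_top
    have hxe : x = (G.len e).toReal := by rw [← hl, ENNReal.toReal_ofReal hx.le]
    rw [hxe, restr, G.pt_toReal_len e ht, tentFun, h.2]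
  · exact restr_tentFun_of_mem_openEdge ⟨hx, hl⟩

theorem derivative_tentFun (hε : 0 < ε) (e : E) : ∀ᵐ x : ℝ, x ∈ G.openEdge e →
    G.derivative (G.tentFun g a c ε) e x = tentSumDeriv a c ε e x := by
  have h : ∀ i, ∀ᵐ x : ℝ, HasDerivAt (tent (c i) ε) (tentDeriv (c i) ε x) x := fun i => by
    have hne : ∀ y : ℝ, ∀ᵐ x : ℝ, x ≠ y := fun y => by simp [ae_iff, measure_singleton]
    filter_upwards [hne (c i - ε), hne (c i), hne (c i + ε)] with x h1 h2 h3
    exact hasDerivAt_tent h1 h2 h3 hε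
  filter_upwards [ae_all_iff.2 h] with x hx hxe
  have heq : G.restr (G.tentFun g a c ε) e =ᶠ[nhds x] tentSum a c ε e := by
    filter_upwards [(G.isOpen_openEdge e).mem_nhds hxe] with y hy
    exact restr_tentFun_of_mem_openEdge hy
  rw [derivative, heq.deriv_eq]
  refine HasDerivAt.deriv (HasDerivAt.fun_sum fun i _ => ?_)
  split_ifs
  · exact hx i
  · exact hasDerivAt_const x 0

theorem measurable_tentSum (e : E) : Measurable (tentSum a c ε e) :=
  Finset.measurable_fun_sum _ fun i _ => by
    split_ifs; exacts [(continuous_tent _ _).measurable, measurable_const]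

theorem measurable_tentSumDeriv (e : E) : Measurable (tentSumDeriv a c ε e) :=
  Finset.measurable_fun_sum _ fun i _ => by
    split_ifs
    · exact (measurable_one.indicator measurableSet_Ioc).sub
        (measurable_one.indicator measurableSet_Ioc)
    · exact measurable_const

theorem eLpPow_tentFun_lt_top {q : ℝ} (hq : 0 < q) :
    G.eLpPow q (G.restr (G.tentFun g a c ε)) < ⊤ := by
  rw [eLpPow_congr fun e => Filter.Eventually.of_forall fun x => restr_tentFun_of_mem_openEdge,
    eLpPow_lt_top_iff hq measurable_tentSum]
  exact memLp_finsetSum _ fun i _ => memLp_fiber (memLp_tent _ _ _) (a i)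

theorem TentCompat.mem_H1 (h : G.TentCompat g a c ε) (hε : 0 < ε) :
    G.tentFun g a c ε ∈ G.H1 := by
  classical
  refine ⟨fun e s t hs hst ht => ?_, eLpPow_tentFun_lt_top two_pos, ?_⟩
  · have : AbsolutelyContinuousOnInterval
        (∑ i, fun x => if e = a i then tent (c i) ε x else 0) s t := by
      refine AbsolutelyContinuousOnInterval.sum _ fun i _ => ?_
      split_ifs
      · exact (lipschitzWith_tent _ _).lipschitzOnWith.absolutelyContinuousOnInterval
      · exact (LipschitzWith.const (0 : ℝ)).lipschitzOnWith.absolutelyContinuousOnInterval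
    refine this.congr fun x hx => ?_
    rw [Set.uIcc_of_le hst] at hx
    rw [h.restr_eq (hs.trans hx.1) ((ENNReal.ofReal_le_ofReal hx.2).trans ht), tentSum,
      Finset.sum_apply]
  · rw [eLpPow_congr (derivative_tentFun hε), eLpPow_lt_top_iff two_pos measurable_tentSumDeriv]
    exact memLp_finsetSum _ fun i _ => memLp_fiber (memLp_tentDeriv _ _ _) (a i)

/-- The tent has slopes `1` and `-1`, so the fundamental theorem of calculus on each half gives a
second difference. It holds for every `c`: the derivative of `restr` vanishes almost everywhere
outside the edge, so nothing is lost when half of the tent lies there. -/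
theorem integrable_derivative_mul_tentDeriv {w : G.Point → ℝ} (hw : w ∈ G.H1) (e : E) (c : ℝ)
    {ε : ℝ} (hε : 0 < ε) :
    Integrable (fun x => G.derivative w e x * tentDeriv c ε x) ∧
    ∫ x in G.openEdge e, G.derivative w e x * tentDeriv c ε x =
      2 * G.restr w e c - (G.restr w e (c - ε) + G.restr w e (c + ε)) := by
  have hac := H1.absolutelyContinuousOnInterval hw e
  have heq : (fun x => G.derivative w e x * tentDeriv c ε x) = fun x =>
      (Set.Ioc (c - ε) c).indicator (G.derivative w e) x -
        (Set.Ioc c (c + ε)).indicator (G.derivative w e) x := by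
    ext x
    simp only [tentDeriv, Set.indicator, Pi.one_apply]
    split_ifs <;> ring
  have h1 : IntegrableOn (G.derivative w e) (Set.Ioc (c - ε) c) :=
    (hac (c - ε) c).intervalIntegrable_deriv.1
  have h2 : IntegrableOn (G.derivative w e) (Set.Ioc c (c + ε)) :=
    (hac c (c + ε)).intervalIntegrable_deriv.1
  have h1' := h1.integrable_indicator measurableSet_Ioc
  have h2' := h2.integrable_indicator measurableSet_Ioc
  have hint : Integrable fun x => G.derivative w e x * tentDeriv c ε x := by
    rw [heq]; exact h1'.sub h2'
  refine ⟨hint, ?_⟩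
  rw [setIntegral_eq_integral_of_ae_compl_eq_zero, heq, integral_sub h1' h2',
    integral_indicator measurableSet_Ioc, integral_indicator measurableSet_Ioc,
    ← intervalIntegral.integral_of_le (by linarith),
    ← intervalIntegral.integral_of_le (by linarith)]
  · have e1 := (hac (c - ε) c).integral_deriv_eq_sub
    have e2 := (hac c (c + ε)).integral_deriv_eq_sub
    simp only [derivative, e1, e2]
    ring
  · filter_upwards [derivative_ae_eq_zero w e] with x hx hxe
    rw [hx hxe, zero_mul]

theorem bilinForm_tentFun [Countable E] {lam : ℝ} {w : G.Point → ℝ} (hw : w ∈ G.H1) (hε : 0 < ε) :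
    G.bilinForm lam w (G.tentFun g a c ε) =
      ∑ i, (2 * G.restr w (a i) (c i) -
        (G.restr w (a i) (c i - ε) + G.restr w (a i) (c i + ε))) +
      lam * ∑ i, ∫ x in G.openEdge (a i), G.restr w (a i) x * tent (c i) ε x := by
  classical
  have key : ∀ {f k : E → ℝ → ℝ} {t : ι → ℝ → ℝ},
      (∀ e, ∀ᵐ x : ℝ, x ∈ G.openEdge e → k e x = ∑ i, if e = a i then t i x else 0) →
      (∀ i, Integrable fun x => f (a i) x * t i x) →
      ∫ s, f s.1 s.2 * k s.1 s.2 ∂G.edgeMeasure =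
        ∑ i, ∫ x in G.openEdge (a i), f (a i) x * t i x := by
    intro f k t hk hi
    have h1 : ∫ s, f s.1 s.2 * k s.1 s.2 ∂G.edgeMeasure =
        ∫ s, ∑ i, (if s.1 = a i then f (a i) s.2 * t i s.2 else 0) ∂G.edgeMeasure := by
      refine integral_congr_ae (ae_edgeMeasure fun e => ?_)
      filter_upwards [hk e] with x hx hxe
      simp only [hx hxe, Finset.mul_sum]
      refine Finset.sum_congr rfl fun i _ => ?_
      split_ifs with h
      · rw [h]
      · rw [mul_zero]
    rw [h1, integral_finsetSum _ fun i _ => integrable_fiber (hi i).integrableOn]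
    exact Finset.sum_congr rfl fun i _ =>
      integral_fiber (fun x => f (a i) x * t i x) (a i)
  rw [bilinForm, key (derivative_tentFun hε)
    fun i => (integrable_derivative_mul_tentDeriv hw (a i) (c i) hε).1,
    key (f := G.restr w) (k := G.restr (G.tentFun g a c ε)) (t := fun i => tent (c i) ε)
      (fun e => Filter.Eventually.of_forall fun x => restr_tentFun_of_mem_openEdge)]
  · congr 1
    exact Finset.sum_congr rfl fun i _ =>
      (integrable_derivative_mul_tentDeriv hw (a i) (c i) hε).2
  · intro i
    refine ((H1.continuous_restr hw (a i)).mul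
      (continuous_tent (c i) ε)).integrable_of_hasCompactSupport ?_
    refine HasCompactSupport.intro (isCompact_Icc (a := c i - ε) (b := c i + ε)) fun x hx => ?_
    simp only [Set.mem_Icc] at hx
    simp only [Pi.mul_apply]
    rw [tent_eq_zero (by grind), mul_zero]

/-- A nonnegative weak supersolution of `-w'' + λ w = 0` which vanishes at the centres of a system
of tents vanishes near these centres. -/
theorem exists_forall_restr_eq_zero [Countable E] {lam : ℝ} {w : G.Point → ℝ} (hw : w ∈ G.H1)
    (hw0 : ∀ y, 0 ≤ w y) (hwc : ∀ i, G.restr w (a i) (c i) = 0) {δ : ℝ} (hδ : 0 < δ)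
    (g : ℝ → V → ℝ)
    (hB : ∀ ε, 0 < ε → ε ≤ δ → 0 ≤ G.bilinForm lam w (G.tentFun (g ε) a c ε)) :
    ∃ η > 0, ∀ i, ∀ x, |x - c i| ≤ η → G.restr w (a i) x = 0 := by
  set n : ℝ := (Fintype.card ι : ℝ) with hn
  have hK : 0 < 2 * |lam| * n + 1 := by positivity
  obtain ⟨η, hη, hηδ, hη1, hηK⟩ : ∃ η > 0, η ≤ δ ∧ η ≤ 1 ∧ η * (2 * |lam| * n) < 1 := by
    -- `η ≤ 1` gives `s * s ≤ η` for `0 ≤ s ≤ η`, and the last bound then makes the zeroth-order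
    -- term too small to balance `S s`.
    refine ⟨min (min δ 1) (1 / (2 * |lam| * n + 1)), by positivity,
      (min_le_left _ _).trans (min_le_left _ _), (min_le_left _ _).trans (min_le_right _ _), ?_⟩
    refine (mul_le_mul_of_nonneg_right (min_le_right _ _) (by positivity)).trans_lt ?_
    rw [one_div_mul_eq_div, div_lt_one hK]
    linarith
  have hr0 : ∀ e x, 0 ≤ G.restr w e x := fun e x => hw0 _
  set S : ℝ → ℝ := fun s => ∑ i, (G.restr w (a i) (c i - s) + G.restr w (a i) (c i + s)) with hS
  have hScont : Continuous S := by
    refine continuous_finsetSum _ fun i _ => ?_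
    have := H1.continuous_restr hw (a i)
    fun_prop
  have hSle : ∀ i x, G.restr w (a i) x ≤ S |x - c i| := by
    intro i x
    refine le_trans ?_ (Finset.single_le_sum (f := fun j =>
      G.restr w (a j) (c j - |x - c i|) + G.restr w (a j) (c j + |x - c i|))
      (fun j _ => add_nonneg (hr0 _ _) (hr0 _ _)) (Finset.mem_univ i))
    rcases abs_cases (x - c i) with ⟨h, _⟩ | ⟨h, _⟩
    · simp only [h, add_sub_cancel]; linarith [hr0 (a i) (c i - (x - c i))]
    · simp only [h, sub_neg_eq_add, add_sub_cancel]; linarith [hr0 (a i) (c i + -(x - c i))]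
  -- The test is made with tents of half-width `s`, a maximum point of `S` on `[0, η]`, so that `S
  -- s` bounds `w` on their whole supports.
  obtain ⟨s, hs, hmax⟩ := isCompact_Icc.exists_isMaxOn (Set.nonempty_Icc.2 hη.le)
    hScont.continuousOn
  have hM : S s ≤ 0 := by
    rcases hs.1.eq_or_lt with rfl | hs0
    · simp [hS, hwc]
    have hSs : 0 ≤ S s := Finset.sum_nonneg fun i _ => add_nonneg (hr0 _ _) (hr0 _ _)
    have h1 := hB s hs0 (hs.2.trans hηδ)
    rw [bilinForm_tentFun hw hs0] at h1
    have h2 : ∀ i, 0 ≤ ∫ x in G.openEdge (a i), G.restr w (a i) x * tent (c i) s x :=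
      fun i => integral_nonneg fun x => mul_nonneg (hr0 _ _) (tent_nonneg _ _ _)
    -- Support of length `2 * s`, `w ≤ S s` there, tent at most `s`.
    have h3 : ∀ i, ∫ x in G.openEdge (a i), G.restr w (a i) x * tent (c i) s x ≤
        2 * s * (S s * s) := by
      intro i
      have hind : ∀ x, G.restr w (a i) x * tent (c i) s x ≤
          (Set.Icc (c i - s) (c i + s)).indicator (fun _ => S s * s) x := by
        intro x
        by_cases hx : x ∈ Set.Icc (c i - s) (c i + s)
        · rw [Set.indicator_of_mem hx]
          have hxs : |x - c i| ≤ s := abs_le.2 ⟨by linarith [hx.1], by linarith [hx.2]⟩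
          exact mul_le_mul ((hSle i x).trans (hmax ⟨abs_nonneg _, hxs.trans hs.2⟩))
            (tent_le hs0.le _ _) (tent_nonneg _ _ _) hSs
        · rw [Set.indicator_of_notMem hx]
          simp only [Set.mem_Icc] at hx
          rw [tent_eq_zero (by grind), mul_zero]
      have hI : Integrable ((Set.Icc (c i - s) (c i + s)).indicator fun _ => S s * s) :=
        (integrable_indicator_iff measurableSet_Icc).2 (integrableOn_const (by simp))
      calc _ ≤ ∫ x in G.openEdge (a i),
            (Set.Icc (c i - s) (c i + s)).indicator (fun _ => S s * s) x :=
            integral_mono_of_nonneg (Filter.Eventually.of_forall fun x =>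
              mul_nonneg (hr0 _ _) (tent_nonneg _ _ _)) hI.restrict
              (Filter.Eventually.of_forall hind)
        _ ≤ ∫ x, (Set.Icc (c i - s) (c i + s)).indicator (fun _ => S s * s) x :=
            setIntegral_le_integral hI (Filter.Eventually.of_forall fun x =>
              Set.indicator_nonneg (fun _ _ => mul_nonneg hSs hs0.le) x)
        _ = _ := by
            rw [integral_indicator measurableSet_Icc, setIntegral_const, smul_eq_mul,
              Real.volume_real_Icc_of_le (by linarith)]
            ring
    have h4 : ∑ i, ∫ x in G.openEdge (a i), G.restr w (a i) x * tent (c i) s x ≤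
        n * (2 * s * (S s * s)) := by
      refine (Finset.sum_le_sum fun i _ => h3 i).trans_eq ?_
      simp [hn]
    have h5 : 0 ≤ ∑ i, ∫ x in G.openEdge (a i), G.restr w (a i) x * tent (c i) s x :=
      Finset.sum_nonneg fun i _ => h2 i
    have h6 : S s ≤ |lam| * (n * (2 * s * (S s * s))) := by
      have : ∑ i, (2 * G.restr w (a i) (c i) -
          (G.restr w (a i) (c i - s) + G.restr w (a i) (c i + s))) = -S s := by
        simp only [hS, hwc, mul_zero, zero_sub, Finset.sum_neg_distrib]
      rw [this] at h1
      have := mul_le_mul_of_nonneg_right (le_abs_self lam) h5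
      have := mul_le_mul_of_nonneg_left h4 (abs_nonneg lam)
      linarith
    have h7 : s * s * (2 * |lam| * n) < 1 := by
      refine lt_of_le_of_lt (mul_le_mul_of_nonneg_right ?_ (by positivity)) hηK
      calc s * s ≤ η * 1 := mul_le_mul hs.2 (hs.2.trans hη1) hs0.le hη.le
        _ = η := mul_one η
    by_contra! hpos
    have := mul_lt_mul_of_pos_left h7 hpos
    linarith
  refine ⟨η, hη, fun i x hx => le_antisymm ?_ (hr0 _ _)⟩
  exact (hSle i x).trans ((hmax ⟨abs_nonneg _, hx⟩).trans hM)

end tents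

/-! ### The strong maximum principle -/

variable (G) in
/-- A nonnegative function of `H¹_Z(G)` which is a weak supersolution of `-w'' + λ w = 0`. -/
structure IsSupersolution (p lam : ℝ) (Z : Set V) (w : G.Point → ℝ) : Prop where
  mem : w ∈ G.H1Z Z
  nonneg : ∀ y, 0 ≤ w y
  bilinForm_nonneg : ∀ φ ∈ G.H1Z Z, (∀ y, 0 ≤ φ y) → G.eLpPow p (G.restr φ) < ⊤ →
    0 ≤ G.bilinForm lam w φ

theorem IsSupersolution.exists_forall_restr_eq_zero [Countable E] {p lam : ℝ} {Z : Set V}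
    {w : G.Point → ℝ} (hw : G.IsSupersolution p lam Z w) (hp : 0 < p) {ι : Type*} [Fintype ι]
    {a : ι → E} {c : ι → ℝ} (hwc : ∀ i, G.restr w (a i) (c i) = 0) {δ : ℝ} (hδ : 0 < δ)
    (g : ℝ → V → ℝ) (hg : ∀ ε, 0 < ε → ε ≤ δ → G.TentCompat (g ε) a c ε)
    (hg0 : ∀ ε, 0 < ε → ∀ v, 0 ≤ g ε v) (hgZ : ∀ ε, ∀ v ∈ Z, g ε v = 0) :
    ∃ η > 0, ∀ i, ∀ x, |x - c i| ≤ η → G.restr w (a i) x = 0 :=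
  MetricGraph.exists_forall_restr_eq_zero hw.mem.1 hw.nonneg hwc hδ g fun ε hε hεδ =>
    hw.bilinForm_nonneg _ ⟨(hg ε hε hεδ).mem_H1 hε, hgZ ε⟩
      (tentFun_nonneg (hg0 ε hε)) (eLpPow_tentFun_lt_top hp)

/-- The zero set in the open edge is closed by continuity and open by testing with a single tent
supported in the edge; the edge is connected. -/
theorem IsSupersolution.eqOn_zero_of_mem_openEdge [Countable E] {p lam : ℝ} {Z : Set V}
    {w : G.Point → ℝ} (hw : G.IsSupersolution p lam Z w) (hp : 0 < p) {e : E} {x : ℝ}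
    (hx : x ∈ G.openEdge e) (hwx : G.restr w e x = 0) :
    ∀ y ∈ G.openEdge e, G.restr w e y = 0 := by
  have hsub : G.openEdge e ⊆ {y | y ∈ G.openEdge e ∧ G.restr w e y = 0} := by
    refine (G.isPreconnected_openEdge e).subset_of_closure_inter_subset ?_ ⟨x, hx, hx, hwx⟩ ?_
    · rw [isOpen_iff_mem_nhds]
      rintro c ⟨hc, hwc⟩
      obtain ⟨δ, hδ, hball⟩ := Metric.isOpen_iff.1 (G.isOpen_openEdge e) c hc
      have hout : ∀ y ∉ G.openEdge e, δ ≤ |y - c| := fun y hy => by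
        by_contra! h
        exact hy (hball (by rwa [Metric.mem_ball, Real.dist_eq]))
      have hend : ∀ e', G.len e' ≠ ⊤ → (G.len e').toReal ∉ G.openEdge e' := fun e' h hm => by
        rw [G.openEdge_of_ne_top e' h] at hm
        exact lt_irrefl _ hm.2
      have hz : ∀ ε ≤ δ, ∀ e' y, (e' = e → y ∉ G.openEdge e) →
          tentSum (fun _ : Unit => e) (fun _ => c) ε e' y = 0 := by
        intro ε hε e' y hy
        rw [tentSum, Fintype.sum_unique]
        split_ifs with h
        · exact tent_eq_zero (hε.trans (hout y (hy h)))
        · rfl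
      obtain ⟨η, hη, H⟩ := hw.exists_forall_restr_eq_zero hp (ι := Unit) (a := fun _ => e)
        (c := fun _ => c) (fun _ => hwc) hδ (fun _ _ => 0)
        (fun ε _ hε => ⟨fun e' => hz ε hε e' 0 fun _ h => lt_irrefl _ h.1, fun e' h =>
          hz ε hε e' _ fun he => he ▸ hend e' h⟩) (fun _ _ _ => le_rfl) (fun _ _ _ => rfl)
      filter_upwards [(G.isOpen_openEdge e).mem_nhds hc, Metric.closedBall_mem_nhds c hη]
        with y hy hy'
      rw [Metric.mem_closedBall, Real.dist_eq] at hy'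
      exact ⟨hy, H () y hy'⟩
    · rintro y ⟨hy, hye⟩
      refine ⟨hye, ?_⟩
      have hcl : IsClosed {y | G.restr w e y = 0} :=
        isClosed_eq (H1.continuous_restr hw.mem.1 e) continuous_const
      exact hcl.closure_subset_iff.2 (fun z hz => hz.2) hy
  exact fun y hy => (hsub hy).2

theorem tentSum_sumElim {ι κ : Type*} [Fintype ι] [Fintype κ] (a : ι → E) (b : κ → E) (c : ι → ℝ)
    (d : κ → ℝ) (ε : ℝ) (e : E) (x : ℝ) :
    tentSum (Sum.elim a b) (Sum.elim c d) ε e x = tentSum a c ε e x + tentSum b d ε e x :=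
  Fintype.sum_sum_type _

/-- One tent is placed at each edge end at `v`, so a loop carries two. As `ε` is at most every
length, a tent centred at one end vanishes at the other, and the values at the vertices agree. -/
theorem tentCompat_vertex {v : V} {ε : ℝ} (hε : 0 ≤ ε)
    (hlen : ∀ e, ENNReal.ofReal ε ≤ G.len e)
    [Fintype {e // G.tail e = v}] [Fintype {e // ∃ h, G.head e h = v}] [DecidableEq V] :
    G.TentCompat (fun u => if u = v then ε else 0)
      (Sum.elim Subtype.val Subtype.val : {e // G.tail e = v} ⊕ {e // ∃ h, G.head e h = v} → E)
      (Sum.elim (fun _ => 0) fun e => (G.len e.1).toReal) ε := by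
  classical
  have hL : ∀ e, G.len e ≠ ⊤ → ε ≤ (G.len e).toReal := fun e he =>
    (ENNReal.ofReal_le_iff_le_toReal he).1 (hlen e)
  constructor
  · intro e
    have h2 : tentSum (fun i : {e // ∃ h, G.head e h = v} => i.1) (fun i => (G.len i.1).toReal)
        ε e 0 = 0 := by
      refine Finset.sum_eq_zero fun i _ => ?_
      split_ifs
      · refine tent_eq_zero ?_
        rw [zero_sub, abs_neg]
        exact (hL _ i.2.1).trans (le_abs_self _)
      · rfl
    rw [tentSum_sumElim, h2, add_zero, tentSum, tent_self hε]
    change _ = if G.tail e = v then ε else 0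
    split_ifs with h
    · rw [Finset.sum_eq_single ⟨e, h⟩ (fun i _ hi => if_neg fun he => hi (Subtype.ext he.symm))
        (by simp), if_pos rfl]
    · exact Finset.sum_eq_zero fun i _ => if_neg fun he => h (by rw [he]; exact i.2)
  · intro e he
    have h1 : tentSum (fun i : {e // G.tail e = v} => i.1) (fun _ => 0) ε e (G.len e).toReal =
        0 := by
      refine Finset.sum_eq_zero fun i _ => ?_
      split_ifs
      · refine tent_eq_zero ?_
        rw [sub_zero]
        exact (hL _ he).trans (le_abs_self _)
      · rfl
    rw [tentSum_sumElim, h1, zero_add, tentSum]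
    change _ = if G.head e he = v then ε else 0
    split_ifs with h
    · rw [Finset.sum_eq_single ⟨e, he, h⟩ (fun i _ hi => if_neg fun he => hi (Subtype.ext he.symm))
        (by simp), if_pos rfl, tent_self hε]
    · refine Finset.sum_eq_zero fun i _ => if_neg fun hei => h ?_
      obtain ⟨_, hi⟩ := i.2
      subst hei
      exact hi

theorem IsInClassG.exists_le_len (hG : G.IsInClassG) :
    ∃ δ > 0, ∀ e, ENNReal.ofReal δ ≤ G.len e := by
  obtain ⟨r, hr, hr'⟩ := ENNReal.lt_iff_exists_nnreal_btwn.1 hG.len_bounded_below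
  refine ⟨r, by exact_mod_cast hr, fun e => ?_⟩
  rw [ENNReal.ofReal_coe_nnreal]
  exact hr'.le.trans (iInf_le _ e)

/-- Finite degree makes the tent system at `v` finite, the lower bound on lengths gives a common
half-width, and `v ∉ Z` makes the test function admissible. Vanishing near the centres reaches every
edge at `v`. -/
theorem IsSupersolution.exists_zero_of_vertex {p lam : ℝ} {Z : Set V}
    {w : G.Point → ℝ} (hw : G.IsSupersolution p lam Z w) (hp : 0 < p) (hG : G.IsInClassG)
    {v : V} (hv : v ∉ Z) (hwv : w (.vertex v) = 0) {e : E} (he : G.Incident e v) :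
    ∃ x ∈ G.openEdge e, G.restr w e x = 0 := by
  classical
  have := hG.countable_edges
  have hdeg := hG.degree_finite v
  have hf1 : {e : E | G.tail e = v}.Finite :=
    Set.encard_lt_top_iff.1 (le_self_add.trans_lt hdeg)
  have hf2 : {e : E | ∃ h : G.len e ≠ ⊤, G.head e h = v}.Finite :=
    Set.encard_lt_top_iff.1 (le_add_self.trans_lt hdeg)
  let _ : Fintype {e // G.tail e = v} := hf1.fintype
  let _ : Fintype {e // ∃ h, G.head e h = v} := hf2.fintype
  obtain ⟨δ, hδ, hlen⟩ := hG.exists_le_len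
  obtain ⟨η, hη, H⟩ := hw.exists_forall_restr_eq_zero hp
    (a := (Sum.elim Subtype.val Subtype.val :
      {e // G.tail e = v} ⊕ {e // ∃ h, G.head e h = v} → E))
    (c := Sum.elim (fun _ => 0) fun e => (G.len e.1).toReal) (by
      rintro (i | i)
      · rw [Sum.elim_inl, Sum.elim_inl, restr, G.pt_of_nonpos _ le_rfl, i.2, hwv]
      · obtain ⟨h, hi⟩ := i.2
        rw [Sum.elim_inr, Sum.elim_inr, restr, G.pt_toReal_len _ h, hi, hwv]) hδ
    (fun ε u => if u = v then ε else 0)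
    (fun ε hε hεδ => tentCompat_vertex hε.le fun e =>
      (ENNReal.ofReal_le_ofReal hεδ).trans (hlen e))
    (fun ε hε u => by split_ifs; exacts [hε.le, le_rfl])
    (fun ε u hu => if_neg (ne_of_mem_of_not_mem hu hv))
  -- Halving `δ` keeps the point at distance `s` from the vertex strictly inside the edge.
  set s := min η (δ / 2) with hs
  have hs0 : 0 < s := lt_min hη (half_pos hδ)
  have hsδ : s < δ := (min_le_right _ _).trans_lt (half_lt_self hδ)
  rcases he with ht | ⟨h, hh⟩
  · refine ⟨s, ⟨hs0, ((ENNReal.ofReal_lt_ofReal_iff hδ).2 hsδ).trans_le (hlen e)⟩,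
      H (.inl ⟨e, ht⟩) s ?_⟩
    rw [Sum.elim_inl, sub_zero, abs_of_pos hs0]
    exact min_le_left _ _
  · have hL : δ ≤ (G.len e).toReal := (ENNReal.ofReal_le_iff_le_toReal h).1 (hlen e)
    refine ⟨(G.len e).toReal - s, ?_, H (.inr ⟨e, h, hh⟩) _ ?_⟩
    · rw [G.openEdge_of_ne_top e h]
      exact ⟨by linarith, by linarith⟩
    · rw [Sum.elim_inr, sub_sub_cancel_left, abs_neg, abs_of_pos hs0]
      exact min_le_left _ _

/-- At a vertex of `Z` the vertex tents are not admissible, but there is no second edge to reach. -/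
theorem eq_of_incident_of_degree_eq_one {v : V} (hv : G.degree v = 1) {e e' : E}
    (he : G.Incident e v) (he' : G.Incident e' v) : e = e' := by
  have h : ({e : E | G.tail e = v} ∪ {e : E | ∃ h, G.head e h = v}).encard ≤ 1 :=
    (Set.encard_union_le _ _).trans hv.le
  exact Set.encard_le_one_iff.1 h e e' he he'

/-- The strong maximum principle: a supersolution which vanishes in the interior of an edge
vanishes identically. -/
theorem IsSupersolution.eq_zero {p lam : ℝ} {Z : Set V} {w : G.Point → ℝ}
    (hw : G.IsSupersolution p lam Z w) (hp : 0 < p) (hG : G.IsInClassG)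
    (hZ : ∀ v ∈ Z, G.degree v = 1) {e : E} {x : ℝ} (hx : x ∈ G.openEdge e)
    (hwx : G.restr w e x = 0) : w = 0 := by
  have := hG.countable_edges
  have step : ∀ v e₁ e₂, G.Incident e₁ v → G.Incident e₂ v →
      (∀ x ∈ G.openEdge e₁, G.restr w e₁ x = 0) → ∀ x ∈ G.openEdge e₂, G.restr w e₂ x = 0 := by
    intro v e₁ e₂ h₁ h₂ hz
    by_cases hv : v ∈ Z
    · rwa [← eq_of_incident_of_degree_eq_one (hZ v hv) h₁ h₂]
    · have hwv : w (.vertex v) = 0 := by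
        rcases h₁ with rfl | ⟨h, rfl⟩
        · exact (H1.eqOn_zero_of_openEdge hw.mem.1 hz).1
        · exact (H1.eqOn_zero_of_openEdge hw.mem.1 hz).2 h
      obtain ⟨y, hy, hwy⟩ := hw.exists_zero_of_vertex hp hG hv hwv h₂
      exact hw.eqOn_zero_of_mem_openEdge hp hy hwy
  have walk : ∀ {u v : V}, G.adjacency.Walk u v →
      (∀ e', G.Incident e' u → ∀ x ∈ G.openEdge e', G.restr w e' x = 0) →
      ∀ e', G.Incident e' v → ∀ x ∈ G.openEdge e', G.restr w e' x = 0 := by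
    intro u v q
    induction q with
    | nil => exact id
    | cons h _ ih =>
      intro hu
      obtain ⟨e₁, h₁, h₂⟩ := adjacency_adj h
      exact ih fun e' he' => step _ e₁ e' h₂ he' (hu e₁ h₁)
  by_contra hne
  obtain ⟨e', y, hy, hwy⟩ := H1.exists_ne_zero hw.mem.1 hG ⟨e⟩ hne
  obtain ⟨q⟩ := hG.connected.preconnected (G.tail e) (G.tail e')
  exact hwy (walk q (fun e₂ h₂ => step _ e e₂ (.inl rfl) h₂
    (hw.eqOn_zero_of_mem_openEdge hp hx hwx)) e' (.inl rfl) y hy)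

/-! ### The levels and the theorem -/

/-- Actions on the Nehari manifold are nonnegative, which excludes `⊥`; the element `w` excludes
`⊤`, the infimum over the empty set. Levels can then be compared in `ℝ`. -/
theorem groundLevel_eq_coe {p lam : ℝ} {Z : Set V} (hp : 2 < p)
    (hlam : -G.omega Z < (lam : EReal)) (hG : G.IsInClassG) (hne : Nonempty E)
    {w : G.Point → ℝ} (hw : w ∈ G.nehari p lam Z) :
    ∃ r : ℝ, G.groundLevel p lam Z = r ∧ ∀ v ∈ G.nehari p lam Z, r ≤ G.action p lam v := by
  have hle : ∀ v ∈ G.nehari p lam Z, G.groundLevel p lam Z ≤ (G.action p lam v : EReal) :=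
    fun v hv => iInf₂_le v hv
  have h0 : 0 ≤ G.groundLevel p lam Z := by
    refine le_iInf₂ fun v hv => ?_
    rw [action_eq_of_mem_nehari hv]
    have : 1 / p ≤ 1 / 2 := one_div_le_one_div_of_le two_pos hp.le
    exact_mod_cast mul_nonneg (by linarith) (H1Z.quadForm_pos hlam hv.1 hG hne hv.2.1).le
  have hbot : G.groundLevel p lam Z ≠ ⊥ := ne_bot_of_le_ne_bot EReal.zero_ne_bot h0
  have htop : G.groundLevel p lam Z ≠ ⊤ := ne_top_of_le_ne_top (EReal.coe_ne_top _) (hle w hw)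
  refine ⟨(G.groundLevel p lam Z).toReal, (EReal.coe_toReal htop hbot).symm, fun v hv => ?_⟩
  rw [← EReal.coe_le_coe_iff, EReal.coe_toReal htop hbot]
  exact hle v hv

end MetricGraph

theorem mainTheorem6 {V E : Type*} (G : MetricGraph V E) (hG : G.IsInClassG)
    (hnc : G.IsNoncompact) (Z : Set V) (hZ : ∀ v ∈ Z, G.degree v = 1)
    (p lam : ℝ) (hp : 2 < p) (hlam : -G.omega Z < (lam : EReal)) :
    2 * G.groundLevel p lam Z ≤ G.nodalLevel p lam Z ∧
      (G.nodalLevel p lam Z = 2 * G.groundLevel p lam Z →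
        ¬ ∃ u, G.IsNodalGroundState p lam Z u) := by
  have hne := hnc.nonempty_edges
  have hp0 : 0 < p := by linarith
  have htwo : ∀ r : ℝ, 2 * (r : EReal) = ((2 * r : ℝ) : EReal) := fun r => by
    rw [EReal.coe_mul]; rfl
  constructor
  · refine le_iInf₂ fun u hu => ?_
    obtain ⟨r, hr, hmin⟩ := MetricGraph.groundLevel_eq_coe hp hlam hG hne hu.2.1
    rw [hr, MetricGraph.action_eq_add hp0 hlam hG hne hu, htwo, EReal.coe_le_coe_iff]
    linarith [hmin _ hu.2.1, hmin _ hu.2.2]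
  · rintro heq ⟨u, hu, hact⟩
    obtain ⟨r, hr, hmin⟩ := MetricGraph.groundLevel_eq_coe hp hlam hG hne hu.2.1
    rw [heq, hr, htwo, EReal.coe_eq_coe_iff, MetricGraph.action_eq_add hp0 hlam hG hne hu] at hact
    -- Two actions, each at least `r`, with sum `2 * r`.
    have hr1 : G.action p lam (fun y => max (u y) 0) = r :=
      le_antisymm (by linarith [hmin _ hu.2.2]) (hmin _ hu.2.1)
    have hnn : ∀ y, 0 ≤ max (u y) 0 := fun y => le_max_right _ _
    have hsuper : G.IsSupersolution p lam Z fun y => max (u y) 0 :=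
      ⟨hu.2.1.1, hnn, fun φ hφ hφ0 hφp => MetricGraph.bilinForm_nonneg_of_minimizer hp hlam hG hne
        hu.2.1 hnn (fun v hv => hr1.trans_le (hmin v hv)) hφ hφ0 hφp⟩
    -- The negative part is nonzero at some interior point of an edge, and there the positive part
    -- vanishes.
    obtain ⟨e, x, hx, hux⟩ := MetricGraph.H1.exists_ne_zero hu.2.2.1.1 hG hne hu.2.2.2.1
    refine hu.2.1.2.1 (hsuper.eq_zero hp0 hG hZ hx ?_)
    simp only [MetricGraph.restr] at hux ⊢
    refine max_eq_right (le_of_not_gt fun h => hux (min_eq_right h.le))
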